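/- Let $\alpha\in(1,2)$ and let $p\ne q$ be integers. For $\beta\ge 0$ and $n=\lfloor\beta\rfloor+1$, the left Riemann–Liouville derivative is $${}_{-\infty}D_x^{\beta}u(x)=\frac{d^n}{dx^n}\,\frac1{\Gamma(n-\beta)}\int_{-\infty}^x (x-\xi)^{n-\beta-1}u(\xi)\,d\xi ;$$ it is said to exist if the integral converges absolutely for every $x$ and is, as a function of $x$, $n-1$ times continuously differentiable with locally absolutely continuous $(n-1)$-st derivative (so that the $n$-th derivative exists almost everywhere). Let $$q_k^{\alpha}=\Big(\frac32\Big)^{\alpha}\sum_{m=0}^{k}3^{-m}g_m^{\alpha}g_{k-m}^{\alpha},\qquad g_k^{\alpha}=(-1)^k\binom{\alpha}{k},$$ be the Taylor coefficients of $\big(\frac32-2\zeta+\frac12\zeta^2\big)^{\alpha}$, and for $h>0$ and $r\in\mathbb Z$ let $${}_LA_r^{\alpha}u(x)=\frac1{h^{\alpha}}\sum_{k=0}^{\infty}q_k^{\alpha}\,u\big(x-(k-r)h\big),$$ $${}_{2L}A_{p,q}^{\alpha}u=w_p\,{}_LA_p^{\alpha}u+w_q\,{}_LA_q^{\alpha}u,\qquad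 w_p=\frac{q}{q-p},\quad w_q=\frac{p}{p-q}.$$ **Theorem 2.1** (Second order approximations for left Riemann–Liouville derivative). Let $u:\mathbb R\to\mathbb C$ be continuous, suppose that ${}_{-\infty}D_x^{\alpha+2}u$ exists, and suppose that $u$, ${}_{-\infty}D_x^{\alpha+2}u$ and their Fourier transforms belong to $L_1(\mathbb R)$. Then ${}_{-\infty}D_x^{\alpha}u$ exists, and exists classically at every point (the fractional integral of order $2-\alpha$ of $u$ is twice continuously differentiable); the series defining ${}_LA_p^{\alpha}u(x)$ and ${}_LA_q^{\alpha}u(x)$ converge absolutely for all $h>0$ and all $x\in\mathbb R$; and $${}_{-\infty}D_x^{\alpha}u(x)={}_{2L}A_{p,q}^{\alpha}u(x)+\mathcal O(h^2),$$ uniformly in $x$: there is a constant $C$ (independent of $h$ and $x$) with $\big|{}_{-\infty}D_x^{\alpha}u(x)-{}_{2L}A_{p,q}^{\alpha}u(x)\big|\le C h^2$ for all $h>0$ and all $x\in\mathbb R$. -/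

import Mathlib

open MeasureTheory Set
open scoped FourierTransform

namespace WSLD

noncomputable section

/-- The left Riemann–Liouville fractional integral of order `γ > 0` with lower limit `-∞`:
`(1 / Γ(γ)) ∫_{-∞}^x (x - ξ)^(γ - 1) u(ξ) dξ`. -/
def rlIntegral (γ : ℝ) (u : ℝ → ℂ) (x : ℝ) : ℂ :=
  (1 / Real.Gamma γ) • ∫ ξ in Iio x, ((x - ξ) ^ (γ - 1) : ℝ) • u ξ

/-- The left Riemann–Liouville derivative of order `β ≥ 0` with lower limit `-∞`: with
`n = ⌊β⌋ + 1`, the `n`-th derivative of the fractional integral of order `n - β`.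
For `β = α ∈ (1, 2)` this is
`(1 / Γ(2 - α)) (d/dx)^2 ∫_{-∞}^x (x - ξ)^(1 - α) u(ξ) dξ`, and for `β = α + 2` it is
`(1 / Γ(2 - α)) (d/dx)^4 ∫_{-∞}^x (x - ξ)^(1 - α) u(ξ) dξ`. -/
def rlDeriv (β : ℝ) (u : ℝ → ℂ) (x : ℝ) : ℂ :=
  iteratedDeriv (⌊β⌋₊ + 1) (rlIntegral ((⌊β⌋₊ + 1 : ℕ) - β) u) x

/-- The left Riemann–Liouville derivative of order `β` of `u` exists (almost everywhere, as an
honest derivative): with `n = ⌊β⌋ + 1`, the integral defining the fractional integral of order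
`n - β` converges absolutely at every point, and the fractional integral is `n - 1` times
continuously differentiable with locally absolutely continuous `(n - 1)`-st derivative. -/
structure HasRLDeriv (β : ℝ) (u : ℝ → ℂ) : Prop where
  integrableOn : ∀ x : ℝ,
    IntegrableOn (fun ξ => ((x - ξ) ^ (((⌊β⌋₊ + 1 : ℕ) - β : ℝ) - 1) : ℝ) • u ξ) (Iio x)
  contDiff : ContDiff ℝ ⌊β⌋₊ (rlIntegral ((⌊β⌋₊ + 1 : ℕ) - β) u)
  absolutelyContinuous : ∀ a b : ℝ, AbsolutelyContinuousOnInterval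
    (iteratedDeriv ⌊β⌋₊ (rlIntegral ((⌊β⌋₊ + 1 : ℕ) - β) u)) a b

/-- `g_k^α = (-1)^k binom(α, k)`, the coefficients of `(1 - ζ)^α`. -/
def gCoeff (α : ℝ) (k : ℕ) : ℝ := (-1) ^ k * Ring.choose α k

/-- The coefficients `q_k^α` of `(3/2 - 2 ζ + ζ^2 / 2)^α = (3/2)^α (1 - ζ)^α (1 - ζ/3)^α`. -/
def qCoeff (α : ℝ) (k : ℕ) : ℝ :=
  (3 / 2 : ℝ) ^ α *
    ∑ m ∈ Finset.range (k + 1), ((3 : ℝ) ^ m)⁻¹ * gCoeff α m * gCoeff α (k - m)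

/-- The shifted Lubich operator with step size `h` and shift `p`:
`h^(-α) ∑_{k ≥ 0} q_k^α u(x - (k - p) h)`. -/
def lubich (α h : ℝ) (p : ℤ) (u : ℝ → ℂ) (x : ℝ) : ℂ :=
  (1 / h ^ α) • ∑' k : ℕ, qCoeff α k • u (x - ((k : ℝ) - (p : ℝ)) * h)

/-- The weighted and shifted Lubich operator `w_p A_p + w_q A_q` with `w_p = q / (q - p)` and
`w_q = p / (p - q)`. -/
def wsld2 (α h : ℝ) (p q : ℤ) (u : ℝ → ℂ) (x : ℝ) : ℂ :=
  ((q : ℝ) / ((q : ℝ) - (p : ℝ))) • lubich α h p u x +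
    ((p : ℝ) / ((p : ℝ) - (q : ℝ))) • lubich α h q u x

end

end WSLD

namespace WSLD

open Filter Topology Asymptotics

/-! ### The coefficients and the symbol of the scheme -/

/-! The proof compares Fourier multipliers. Write `u` as the inverse Fourier integral of its
transform M and put γ = 2 - α. By exponential damping and the Gamma integral with complex rate, the
fractional integral of order γ has multiplier form G = (2πiω)^(-γ) M (`rlIntegral_eq_invF`). Its
fourth derivative is given only almost everywhere, with integrable transform F; absolute continuity
makes it the classical derivative `invF F` (`hasDerivAt_of_absolutelyContinuous`), and unit
differences yield F = (2πiω)^4 G (`ae_eq_of_hasDerivAt_four`). Hence |ω|^(α+2) |M| is integrable.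
This allows two differentiations under the integral, so that D^α u has multiplier (2πiω)^α, and it
later controls the error.

The scheme has multiplier h^(-α) S(z) at z = 2πiωh, with S(z) = (w_p e^(pz) + w_q e^(qz)) (3/2 -
2e^(-z) + e^(-2z)/2)^α. The stencil inside the power is z + O(z^3), and the weights cancel the
first-order effect of the shifts, so S(z) - z^α = O(|z|^(α+2)) near 0 on the imaginary axis. Away
from 0 the same bound holds because S is bounded, the q_k being absolutely summable
(`exists_symbol_bound`). After scaling, the error is at most C h^2 ∫ |2πω|^(α+2) |M|. -/

lemma ringChoose_succ_mul (a : ℝ) (k : ℕ) :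
    Ring.choose a (k + 1) * (k + 1) = Ring.choose a k * (a - k) := by
  have h1 := Ring.descPochhammer_eq_factorial_smul_choose a (k + 1)
  have h0 := Ring.descPochhammer_eq_factorial_smul_choose a k
  rw [descPochhammer_succ_right, Polynomial.smeval_mul, h0, Polynomial.smeval_sub,
    Polynomial.smeval_X, Polynomial.smeval_natCast, Nat.factorial_succ] at h1
  simp only [nsmul_eq_mul, pow_one, pow_zero, Nat.cast_mul, Nat.cast_add, Nat.cast_one,
    mul_one] at h1
  have hk : (k.factorial : ℝ) ≠ 0 := by positivity
  apply mul_left_cancel₀ hk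
  linarith

lemma gCoeff_zero (a : ℝ) : gCoeff a 0 = 1 := by simp [gCoeff]

lemma gCoeff_succ_mul (a : ℝ) (k : ℕ) : gCoeff a (k + 1) * (k + 1) = gCoeff a k * (k - a) := by
  have := ringChoose_succ_mul a k
  simp only [gCoeff, pow_succ]
  linear_combination (-(-1) ^ k) * this

lemma gCoeff_one (a : ℝ) : gCoeff a 1 = -a := by simp [gCoeff]

/-- Pascal's rule; in generating functions, (1 - ζ)^a / (1 - ζ) = (1 - ζ)^(a-1). -/
lemma sum_range_gCoeff (a : ℝ) (n : ℕ) :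
    ∑ k ∈ Finset.range (n + 1), gCoeff a k = gCoeff (a - 1) n := by
  induction n with
  | zero => simp [gCoeff]
  | succ n ih =>
    rw [Finset.sum_range_succ, ih]
    have := Ring.choose_succ_succ (a - 1) n
    rw [sub_add_cancel] at this
    simp only [gCoeff, this, pow_succ]
    ring

/-- The recurrence factor k - a is nonnegative from k = 1 on, so the sign of g_1 = -a persists. -/
lemma gCoeff_succ_nonpos {a : ℝ} (h0 : 0 ≤ a) (h1 : a ≤ 1) (k : ℕ) : gCoeff a (k + 1) ≤ 0 := by
  induction k with
  | zero => simpa [gCoeff_one] using h0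
  | succ k ih =>
    have h := gCoeff_succ_mul a (k + 1)
    have hk : (0 : ℝ) < ((k + 1 : ℕ) : ℝ) + 1 := by positivity
    by_contra! hc
    have h2 : gCoeff a (k + 1) * (((k + 1 : ℕ) : ℝ) - a) ≤ 0 :=
      mul_nonpos_of_nonpos_of_nonneg ih (by push_cast; linarith [k.cast_nonneg (α := ℝ)])
    nlinarith [mul_pos hc hk]

lemma gCoeff_add_two_nonneg {a : ℝ} (h0 : 1 ≤ a) (h1 : a ≤ 2) (k : ℕ) : 0 ≤ gCoeff a (k + 2) := by
  induction k with
  | zero =>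
    have h := gCoeff_succ_mul a 1
    rw [gCoeff_one] at h
    norm_num at h ⊢
    nlinarith
  | succ k ih =>
    have h := gCoeff_succ_mul a (k + 2)
    have hk : (0 : ℝ) < ((k + 2 : ℕ) : ℝ) + 1 := by positivity
    by_contra! hc
    have h2 : 0 ≤ gCoeff a (k + 2) * (((k + 2 : ℕ) : ℝ) - a) :=
      mul_nonneg ih (by push_cast; linarith [k.cast_nonneg (α := ℝ)])
    nlinarith [mul_neg_of_neg_of_pos hc hk]

/-- From index 2 on the terms are nonnegative, so bounded partial sums suffice. Including the first
two terms 1 - a, a partial sum is a coefficient of order a - 1, hence nonpositive; this gives the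
bound a - 1. -/
lemma summable_norm_gCoeff {a : ℝ} (ha : a ∈ Ioo (1 : ℝ) 2) : Summable fun k => ‖gCoeff a k‖ := by
  rw [← summable_nat_add_iff 2]
  have hn := gCoeff_add_two_nonneg ha.1.le ha.2.le
  refine summable_of_sum_range_le (c := a - 1) (fun k => norm_nonneg _) fun n => ?_
  simp_rw [Real.norm_of_nonneg (hn _)]
  have h := sum_range_gCoeff a (n + 1)
  rw [Finset.sum_range_succ', Finset.sum_range_succ'] at h
  have h2 := gCoeff_succ_nonpos (a := a - 1) (by linarith [ha.1]) (by linarith [ha.2]) n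
  simp only [zero_add, gCoeff_zero, gCoeff_one] at h
  have : ∑ k ∈ Finset.range n, gCoeff a (k + 2) = ∑ k ∈ Finset.range n, gCoeff a (k + 1 + 1) := rfl
  linarith

lemma summable_norm_gCoeff_mul_pow {a : ℝ} (ha : a ∈ Ioo (1 : ℝ) 2) {ζ : ℂ} (hζ : ‖ζ‖ ≤ 1) :
    Summable fun k => ‖(gCoeff a k : ℂ) * ζ ^ k‖ := by
  refine (summable_norm_gCoeff ha).of_nonneg_of_le (fun _ => norm_nonneg _) fun k => ?_
  rw [norm_mul, norm_pow, Complex.norm_real]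
  exact mul_le_of_le_one_right (norm_nonneg _) (pow_le_one₀ (norm_nonneg _) hζ)

/-- The binomial series for `(1 - ζ)^a` on the closed unit disc. -/
lemma tsum_gCoeff_mul_pow {a : ℝ} (ha : a ∈ Ioo (1 : ℝ) 2) {ζ : ℂ} (hζ : ‖ζ‖ ≤ 1) :
    ∑' k, (gCoeff a k : ℂ) * ζ ^ k = (1 - ζ) ^ (a : ℂ) := by
  have hball : EqOn (fun ζ : ℂ => ∑' k, (gCoeff a k : ℂ) * ζ ^ k) (fun ζ => (1 - ζ) ^ (a : ℂ))
      (Metric.ball 0 1) := by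
    intro z hz
    have hz' : -z ∈ Metric.eball (0 : ℂ) 1 := by
      rw [← ENNReal.ofReal_one, Metric.eball_ofReal]; simpa using hz
    have h := (Complex.one_add_cpow_hasFPowerSeriesOnBall_zero (a := (a : ℂ))).hasSum hz'
    simp only [binomialSeries_apply, zero_add, List.ofFn_const, List.prod_replicate, smul_eq_mul] at h
    simp only [sub_eq_add_neg]
    rw [← h.tsum_eq]
    refine tsum_congr fun k => ?_
    rw [neg_pow z]
    simp only [gCoeff]
    push_cast [Complex.ofReal_choose]
    ring
  -- Both sides are continuous up to the boundary: the series by uniform convergence, the power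
  -- because its exponent is positive, even at ζ = 1 where the base vanishes.
  refine hball.of_subset_closure (t := Metric.closedBall 0 1) ?_ ?_ Metric.ball_subset_closedBall
    (closure_ball (0 : ℂ) one_ne_zero).ge (by simpa using hζ)
  · refine continuousOn_tsum (fun k => by fun_prop) (summable_norm_gCoeff ha) fun k z hz => ?_
    rw [norm_mul, norm_pow, Complex.norm_real]
    exact mul_le_of_le_one_right (norm_nonneg _)
      (pow_le_one₀ (norm_nonneg _) (by simpa using hz))
  · intro z hz
    have hre : z.re ≤ 1 := (Complex.re_le_norm z).trans (by simpa using hz)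
    refine ContinuousAt.continuousWithinAt ?_
    exact ContinuousAt.comp (f := fun z : ℂ => 1 - z) (g := fun z : ℂ => z ^ (a : ℂ))
      (Complex.continuousAt_cpow_const_of_re_pos (Or.inl (by simpa using hre))
        (by simpa using by linarith [ha.1])) (by fun_prop)

lemma summable_norm_gCoeff_third {a : ℝ} (ha : a ∈ Ioo (1 : ℝ) 2) :
    Summable fun k => ‖((3 : ℝ) ^ k)⁻¹ * gCoeff a k‖ := by
  refine (summable_norm_gCoeff ha).of_nonneg_of_le (fun _ => norm_nonneg _) fun k => ?_
  rw [norm_mul]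
  refine mul_le_of_le_one_left (norm_nonneg _) ?_
  rw [norm_inv, norm_pow]
  exact inv_le_one_of_one_le₀ (one_le_pow₀ (by norm_num))

lemma summable_norm_qCoeff {a : ℝ} (ha : a ∈ Ioo (1 : ℝ) 2) : Summable fun k => ‖qCoeff a k‖ := by
  have h := summable_norm_sum_mul_range_of_summable_norm (summable_norm_gCoeff_third ha)
    (summable_norm_gCoeff ha)
  simp only [qCoeff, norm_mul]
  exact h.mul_left _

lemma tsum_qCoeff_mul_pow {a : ℝ} (ha : a ∈ Ioo (1 : ℝ) 2) {ζ : ℂ} (hζ : ‖ζ‖ ≤ 1) :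
    ∑' k, (qCoeff a k : ℂ) * ζ ^ k =
      ((3 / 2 : ℝ) : ℂ) ^ (a : ℂ) * ((1 - ζ / 3) ^ (a : ℂ) * (1 - ζ) ^ (a : ℂ)) := by
  have hζ3 : ‖ζ / 3‖ ≤ 1 := by
    rw [norm_div]; norm_num; linarith
  rw [← tsum_gCoeff_mul_pow ha hζ, ← tsum_gCoeff_mul_pow ha hζ3,
    tsum_mul_tsum_eq_tsum_sum_range_of_summable_norm (summable_norm_gCoeff_mul_pow ha hζ3)
      (summable_norm_gCoeff_mul_pow ha hζ), ← tsum_mul_left]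
  refine tsum_congr fun k => ?_
  rw [qCoeff, Complex.ofReal_mul, Complex.ofReal_cpow (by norm_num), mul_assoc]
  congr 1
  rw [Complex.ofReal_sum, Finset.sum_mul]
  refine Finset.sum_congr rfl fun m hm => ?_
  have : ζ ^ k = ζ ^ m * ζ ^ (k - m) := by
    rw [← pow_add, Nat.add_sub_cancel' (by simpa [Nat.lt_succ_iff] using hm)]
  rw [this, div_pow]
  push_cast
  ring

/-! ### Branches of complex powers and expansion of the symbol at 0 -/

lemma mul_cpow_of_arg {x y : ℂ} (hx : x ≠ 0) (hy : y ≠ 0) (c : ℂ)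
    (h : x.arg + y.arg ∈ Ioc (-Real.pi) Real.pi) : (x * y) ^ c = x ^ c * y ^ c := by
  rw [Complex.cpow_def_of_ne_zero (mul_ne_zero hx hy), Complex.cpow_def_of_ne_zero hx,
    Complex.cpow_def_of_ne_zero hy, Complex.log_mul hx hy h, add_mul, Complex.exp_add]

/-- The arguments lie in [-π/2, π/2] and (-π/2, π/2), so their sum never crosses the branch cut. -/
lemma mul_cpow_of_re {x y : ℂ} (hx : x ≠ 0) (hxr : 0 ≤ x.re) (hy : 0 < y.re) (c : ℂ) :
    (x * y) ^ c = x ^ c * y ^ c := by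
  have hy0 : y ≠ 0 := by rintro rfl; simp at hy
  have h1 := abs_le.1 (Complex.abs_arg_le_pi_div_two_iff.2 hxr)
  have h2 := abs_lt.1 (Complex.abs_arg_lt_pi_div_two_iff.2 (Or.inl hy))
  exact mul_cpow_of_arg hx hy0 c ⟨by linarith, by linarith⟩

lemma ofReal_mul_cpow {r : ℝ} (hr : 0 < r) (x : ℂ) {c : ℂ} (hc : c ≠ 0) :
    ((r : ℂ) * x) ^ c = (r : ℂ) ^ c * x ^ c := by
  rcases eq_or_ne x 0 with rfl | hx
  · simp [hc]
  · have hr' : (r : ℂ) ≠ 0 := by exact_mod_cast hr.ne'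
    rw [Complex.cpow_def_of_ne_zero (mul_ne_zero hr' hx), Complex.cpow_def_of_ne_zero hr',
      Complex.cpow_def_of_ne_zero hx, Complex.log_ofReal_mul hr hx, add_mul, Complex.exp_add,
      Complex.ofReal_log hr.le]

/-- The ratio `(3/2 - 2 e^{-z} + e^{-2z}/2) / z`. -/
noncomputable def stencilRatio (z : ℂ) : ℂ :=
  (1 - Complex.exp (-z)) / z * ((3 - Complex.exp (-z)) / 2)

lemma tendsto_one_sub_exp_neg_div :
    Tendsto (fun z : ℂ => (1 - Complex.exp (-z)) / z) (𝓝[≠] 0) (𝓝 1) := by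
  have h : HasDerivAt (fun z : ℂ => 1 - Complex.exp (-z)) 1 0 := by
    simpa using ((hasDerivAt_neg (0 : ℂ)).cexp).const_sub 1
  refine h.tendsto_slope.congr fun z => ?_
  simp [slope_def_field]

lemma tendsto_three_sub_exp_neg :
    Tendsto (fun z : ℂ => (3 - Complex.exp (-z)) / 2) (𝓝[≠] 0) (𝓝 1) := by
  have h : Continuous fun z : ℂ => (3 - Complex.exp (-z)) / 2 := by fun_prop
  have := (h.tendsto 0).mono_left (nhdsWithin_le_nhds (s := {0}ᶜ))
  convert this using 2
  norm_num

lemma tendsto_stencilRatio : Tendsto stencilRatio (𝓝[≠] 0) (𝓝 1) := by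
  have h : Tendsto stencilRatio (𝓝[≠] 0) (𝓝 (1 * 1)) :=
    tendsto_one_sub_exp_neg_div.mul tendsto_three_sub_exp_neg
  rwa [mul_one] at h

lemma stencilRatio_sub_one_isBigO :
    (fun z => stencilRatio z - 1) =O[𝓝[≠] 0] fun z : ℂ => z ^ 2 := by
  have h := Complex.exp_sub_sum_range_isBigO_pow 3
  have h1 : (fun z : ℂ => Complex.exp (-z) - ∑ i ∈ Finset.range 3, (-z) ^ i / (i.factorial : ℂ))
      =O[𝓝 0] fun z : ℂ => z ^ 3 := by
    have ht : Tendsto (fun z : ℂ => -z) (𝓝 0) (𝓝 0) := by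
      simpa using (continuous_neg (G := ℂ)).tendsto 0
    refine (h.comp_tendsto ht).trans (IsBigO.of_bound 1 (Eventually.of_forall fun z => ?_))
    simp
  have h2 : (fun z : ℂ => Complex.exp (-2 * z) -
      ∑ i ∈ Finset.range 3, (-2 * z) ^ i / (i.factorial : ℂ)) =O[𝓝 0] fun z : ℂ => z ^ 3 := by
    have ht : Tendsto (fun z : ℂ => -2 * z) (𝓝 0) (𝓝 0) := by
      simpa using (continuous_const_mul (-2 : ℂ)).tendsto 0
    refine (h.comp_tendsto ht).trans ?_
    simp only [Function.comp_def, mul_pow]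
    exact isBigO_const_mul_self _ _ _
  -- With the stencil weights -2 and 1/2 the quadratic Taylor terms cancel, leaving z + O(z^3);
  -- dividing by z gives the claim.
  have h3 := ((h1.const_mul_left (-2)).add (h2.const_mul_left (1 / 2))).mono
    (nhdsWithin_le_nhds (s := {0}ᶜ))
  have h4 := h3.mul (isBigO_refl (fun z : ℂ => z⁻¹) (𝓝[≠] 0))
  refine (h4.congr' ?_ ?_)
  · filter_upwards [self_mem_nhdsWithin] with z hz
    have hz : z ≠ 0 := hz
    have he : Complex.exp (-2 * z) = Complex.exp (-z) ^ 2 := by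
      rw [← Complex.exp_nat_mul]; congr 1; push_cast; ring
    rw [he]
    simp only [stencilRatio, Finset.sum_range_succ, Finset.sum_range_zero, Nat.factorial]
    field_simp
    push_cast
    ring
  · filter_upwards [self_mem_nhdsWithin] with z hz
    have hz : z ≠ 0 := hz
    field_simp

/-- The weights solve w_p + w_q = 1 and p w_p + q w_q = 0, which removes the linear term. -/
lemma weightedShift_sub_one_isBigO {p q : ℤ} (hpq : p ≠ q) :
    (fun z : ℂ => (((q : ℝ) / ((q : ℝ) - p) : ℝ) : ℂ) * Complex.exp (p * z) +
      (((p : ℝ) / ((p : ℝ) - q) : ℝ) : ℂ) * Complex.exp (q * z) - 1)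
      =O[𝓝[≠] 0] fun z : ℂ => z ^ 2 := by
  have key : ∀ r : ℤ, (fun z : ℂ => Complex.exp (r * z) - (1 + r * z)) =O[𝓝 0]
      fun z : ℂ => z ^ 2 := by
    intro r
    have ht : Tendsto (fun z : ℂ => (r : ℂ) * z) (𝓝 0) (𝓝 0) := by
      simpa using (continuous_const_mul (r : ℂ)).tendsto 0
    refine IsBigO.trans (((Complex.exp_sub_sum_range_isBigO_pow 2).comp_tendsto ht).congr_left
      fun z => ?_) ?_
    · simp [Finset.sum_range_succ]
    · simp only [Function.comp_def, mul_pow]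
      exact isBigO_const_mul_self _ _ _
  refine ((((key p).const_mul_left (((q : ℝ) / ((q : ℝ) - p) : ℝ) : ℂ)).add
    ((key q).const_mul_left (((p : ℝ) / ((p : ℝ) - q) : ℝ) : ℂ))).mono
    nhdsWithin_le_nhds).congr_left fun z => ?_
  have h1 : (q : ℂ) - p ≠ 0 := by
    rw [sub_ne_zero]; exact_mod_cast hpq.symm
  have h2 : (p : ℂ) - q ≠ 0 := by
    rw [sub_ne_zero]; exact_mod_cast hpq
  have h3 : (q : ℂ) / (q - p) = 1 - p / (p - q) := by
    field_simp; ring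
  have h4 : (p : ℂ) / (p - q) * (p - q) = p := by field_simp
  push_cast
  rw [h3]
  linear_combination z * h4

/-- With A the shift factor and B the power, AB - 1 = (A - 1)B + (B - 1); here B - 1 is O(z^2)
because w ↦ w^a is differentiable at 1. -/
lemma symbol_local_isBigO {p q : ℤ} (hpq : p ≠ q) (a : ℂ) :
    (fun z : ℂ => ((((q : ℝ) / ((q : ℝ) - p) : ℝ) : ℂ) * Complex.exp (p * z) +
      (((p : ℝ) / ((p : ℝ) - q) : ℝ) : ℂ) * Complex.exp (q * z)) * stencilRatio z ^ a - 1)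
      =O[𝓝[≠] 0] fun z : ℂ => z ^ 2 := by
  have hd : HasDerivAt (fun z : ℂ => z ^ a) (a * 1 ^ (a - 1) * 1) 1 :=
    (hasDerivAt_id (1 : ℂ)).cpow_const (Or.inl (by simp))
  have h1 : (fun z => stencilRatio z ^ a - 1) =O[𝓝[≠] 0] fun z : ℂ => z ^ 2 := by
    have := hd.isBigO_sub.comp_tendsto tendsto_stencilRatio
    simp only [Function.comp_def, Complex.one_cpow] at this
    exact this.trans stencilRatio_sub_one_isBigO
  have h2 : (fun z => stencilRatio z ^ a) =O[𝓝[≠] 0] fun _ : ℂ => (1 : ℂ) := by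
    have := hd.continuousAt.tendsto.comp tendsto_stencilRatio
    exact this.isBigO_one ℂ
  have h3 := ((weightedShift_sub_one_isBigO hpq).mul h2).add
    (h1.congr_right (g₂ := fun z : ℂ => z ^ 2 * 1) (by simp))
  refine (h3.congr_left fun z => ?_).congr_right (by simp)
  ring

/-- The condition z.re = 0 puts e^(-z) on the unit circle, where the series converges, and keeps arg
z at ±π/2. Near 0 the other factors are close to 1, so the power splits. -/
lemma tsum_qCoeff_eq_stencilRatio {a : ℝ} (ha : a ∈ Ioo (1 : ℝ) 2) :
    ∀ᶠ z : ℂ in 𝓝[≠] 0, z.re = 0 → ∑' k, (qCoeff a k : ℂ) * Complex.exp (-z) ^ k =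
      z ^ (a : ℂ) * stencilRatio z ^ (a : ℂ) := by
  have hc : (a : ℂ) ≠ 0 := by exact_mod_cast (by linarith [ha.1] : (0 : ℝ) < a).ne'
  have hre : ∀ᶠ w : ℂ in 𝓝 1, 0 < w.re :=
    (isOpen_lt continuous_const Complex.continuous_re).mem_nhds (by simp)
  filter_upwards [self_mem_nhdsWithin, tendsto_one_sub_exp_neg_div.eventually hre,
    tendsto_three_sub_exp_neg.eventually hre] with z hz h1 h2 hz0
  have hz : z ≠ 0 := hz
  have hn : ‖Complex.exp (-z)‖ ≤ 1 := by simp [Complex.norm_exp, hz0]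
  have e1 : ((3 / 2 : ℝ) : ℂ) * (1 - Complex.exp (-z) / 3) = (3 - Complex.exp (-z)) / 2 := by
    push_cast; ring
  have e2 : 1 - Complex.exp (-z) = z * ((1 - Complex.exp (-z)) / z) := by field_simp
  have h10 : (1 - Complex.exp (-z)) / z ≠ 0 := by intro h; simp [h] at h1
  rw [tsum_qCoeff_mul_pow ha hn, ← mul_assoc, ← ofReal_mul_cpow (by norm_num) _ hc, e1, e2,
    mul_cpow_of_re hz hz0.ge h1, stencilRatio, mul_cpow_of_re h10 h1.le h2]
  ring

lemma norm_tsum_qCoeff_le {a : ℝ} (ha : a ∈ Ioo (1 : ℝ) 2) {ζ : ℂ} (hζ : ‖ζ‖ ≤ 1) :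
    ‖∑' k, (qCoeff a k : ℂ) * ζ ^ k‖ ≤ ∑' k, ‖qCoeff a k‖ := by
  refine tsum_of_norm_bounded (summable_norm_qCoeff ha).hasSum fun k => ?_
  rw [norm_mul, norm_pow, Complex.norm_real]
  exact mul_le_of_le_one_right (norm_nonneg _) (pow_le_one₀ (norm_nonneg _) hζ)

/-- The symbol of the weighted and shifted operator agrees with `z^a` to second order. -/
lemma exists_symbol_bound {a : ℝ} (ha : a ∈ Ioo (1 : ℝ) 2) {p q : ℤ} (hpq : p ≠ q) :
    ∃ C : ℝ, ∀ z : ℂ, z.re = 0 →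
      ‖((((q : ℝ) / ((q : ℝ) - p) : ℝ) : ℂ) * Complex.exp (p * z) +
        (((p : ℝ) / ((p : ℝ) - q) : ℝ) : ℂ) * Complex.exp (q * z)) *
          (∑' k, (qCoeff a k : ℂ) * Complex.exp (-z) ^ k) - z ^ (a : ℂ)‖ ≤
        C * ‖z‖ ^ (a + 2) := by
  have ha0 : 0 < a := by linarith [ha.1]
  obtain ⟨C, hC⟩ := (symbol_local_isBigO hpq (a : ℂ)).bound
  have hev := hC.and (tsum_qCoeff_eq_stencilRatio ha)
  rw [eventually_nhdsWithin_iff, Metric.eventually_nhds_iff] at hev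
  obtain ⟨δ, hδ, hev⟩ := hev
  set wp : ℝ := (q : ℝ) / ((q : ℝ) - p)
  set wq : ℝ := (p : ℝ) / ((p : ℝ) - q)
  set M := (‖wp‖ + ‖wq‖) * ∑' k, ‖qCoeff a k‖ with hM
  have hM0 : 0 ≤ M := mul_nonneg (by positivity) (tsum_nonneg fun _ => norm_nonneg _)
  -- `C` serves for ‖z‖ < δ. For ‖z‖ ≥ δ the crude bound M + ‖z‖^a is enlarged by powers of ‖z‖/δ ≥
  -- 1.
  refine ⟨max C (M / δ ^ (a + 2) + 1 / δ ^ 2), fun z hz => ?_⟩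
  rcases eq_or_ne z 0 with rfl | hz0
  · have h0 : (a : ℂ) ≠ 0 := by exact_mod_cast ha0.ne'
    have := tsum_qCoeff_mul_pow ha (ζ := 1) (by simp)
    simp only [sub_self, Complex.zero_cpow h0, mul_zero, one_pow, mul_one] at this
    simp [this, h0, Real.zero_rpow (by linarith : a + 2 ≠ 0)]
  have hzn : 0 < ‖z‖ := norm_pos_iff.2 hz0
  have hpow : ‖z‖ ^ (a + 2) = ‖z‖ ^ a * ‖z‖ ^ 2 := by
    rw [Real.rpow_add hzn, Real.rpow_two]
  rcases lt_or_ge ‖z‖ δ with hlt | hge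
  · obtain ⟨h1, h2⟩ := hev (by simpa using hlt) hz0
    rw [h2 hz]
    refine le_trans ?_ (mul_le_mul_of_nonneg_right (le_max_left _ _) (by positivity))
    rw [norm_pow] at h1
    calc _ = ‖z ^ (a : ℂ) * (((wp : ℂ) * Complex.exp (p * z) + (wq : ℂ) * Complex.exp (q * z)) *
          stencilRatio z ^ (a : ℂ) - 1)‖ := by congr 1; ring
      _ = ‖z‖ ^ a * ‖((wp : ℂ) * Complex.exp (p * z) + (wq : ℂ) * Complex.exp (q * z)) *
          stencilRatio z ^ (a : ℂ) - 1‖ := by rw [norm_mul, Complex.norm_cpow_real]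
      _ ≤ ‖z‖ ^ a * (C * ‖z‖ ^ 2) := by gcongr
      _ = C * ‖z‖ ^ (a + 2) := by rw [hpow]; ring
  · refine le_trans ?_ (mul_le_mul_of_nonneg_right (le_max_right _ _) (by positivity))
    have hexp : ∀ r : ℤ, ‖Complex.exp (r * z)‖ = 1 := fun r => by simp [Complex.norm_exp, hz]
    have hn : ‖Complex.exp (-z)‖ ≤ 1 := by simp [Complex.norm_exp, hz]
    have hB : ‖(wp : ℂ) * Complex.exp (p * z) + (wq : ℂ) * Complex.exp (q * z)‖ ≤
        ‖wp‖ + ‖wq‖ := by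
      refine (norm_add_le _ _).trans ?_
      rw [norm_mul, norm_mul, hexp, hexp, Complex.norm_real, Complex.norm_real, mul_one, mul_one]
    calc _ ≤ ‖((wp : ℂ) * Complex.exp (p * z) + (wq : ℂ) * Complex.exp (q * z)) *
          (∑' k, (qCoeff a k : ℂ) * Complex.exp (-z) ^ k)‖ + ‖z ^ (a : ℂ)‖ := norm_sub_le _ _
      _ ≤ M + ‖z‖ ^ a := by
        rw [norm_mul, Complex.norm_cpow_real]
        have := norm_tsum_qCoeff_le ha hn
        gcongr
        exact mul_le_mul hB this (norm_nonneg _) (by positivity)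
      _ ≤ M * (‖z‖ ^ (a + 2) / δ ^ (a + 2)) + ‖z‖ ^ a * (‖z‖ ^ 2 / δ ^ 2) := by
        gcongr
        · refine le_mul_of_one_le_right hM0 ((one_le_div (by positivity)).2 ?_)
          gcongr
        · refine le_mul_of_one_le_right (by positivity) ((one_le_div (by positivity)).2 ?_)
          gcongr
      _ = _ := by rw [hpow]; ring

/-! ### The Gamma integral with a complex rate -/

lemma integrableOn_rpow_mul_exp_neg {s b : ℝ} (hs : -1 < s) (hb : 0 < b) :
    IntegrableOn (fun t : ℝ => t ^ s * Real.exp (-b * t)) (Ioi 0) := by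
  simpa using integrableOn_rpow_mul_exp_neg_mul_rpow (p := 1) hs one_pos hb

lemma norm_rpow_mul_cexp_neg {s t : ℝ} (ht : 0 < t) (r : ℂ) :
    ‖((t ^ s : ℝ) : ℂ) * Complex.exp (-(r * t))‖ = t ^ s * Real.exp (-r.re * t) := by
  rw [norm_mul, Complex.norm_real, Real.norm_of_nonneg (by positivity), Complex.norm_exp]
  simp

lemma aestronglyMeasurable_rpow_mul_cexp_neg (s : ℝ) (r : ℂ) (μ : Measure ℝ) :
    AEStronglyMeasurable (fun t : ℝ => ((t ^ s : ℝ) : ℂ) * Complex.exp (-(r * t))) μ := by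
  refine Measurable.aestronglyMeasurable ?_
  fun_prop

lemma integrableOn_rpow_mul_cexp_neg {s : ℝ} (hs : -1 < s) {r : ℂ} (hr : 0 < r.re) :
    IntegrableOn (fun t : ℝ => ((t ^ s : ℝ) : ℂ) * Complex.exp (-(r * t))) (Ioi 0) := by
  refine (integrableOn_rpow_mul_exp_neg hs hr).mono'
    (aestronglyMeasurable_rpow_mul_cexp_neg s r _) ?_
  filter_upwards [ae_restrict_mem measurableSet_Ioi] with t ht
  rw [norm_rpow_mul_cexp_neg ht]

lemma differentiableAt_integral_rpow_mul_cexp_neg {s : ℝ} (hs : -1 < s) {r : ℂ} (hr : 0 < r.re) :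
    DifferentiableAt ℂ
      (fun r : ℂ => ∫ t in Ioi (0 : ℝ), ((t ^ s : ℝ) : ℂ) * Complex.exp (-(r * t))) r := by
  have hU : {w : ℂ | r.re / 2 < w.re} ∈ 𝓝 r :=
    (isOpen_lt continuous_const Complex.continuous_re).mem_nhds (half_lt_self hr)
  refine (hasDerivAt_integral_of_dominated_loc_of_deriv_le
    (F' := fun w t => ((t ^ s : ℝ) : ℂ) * (Complex.exp (-(w * t)) * (-(t : ℂ))))
    (bound := fun t => t ^ (s + 1) * Real.exp (-(r.re / 2) * t)) hU
    (Eventually.of_forall fun w => aestronglyMeasurable_rpow_mul_cexp_neg s w _)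
    (integrableOn_rpow_mul_cexp_neg hs hr) (Measurable.aestronglyMeasurable (by fun_prop)) ?_
    (integrableOn_rpow_mul_exp_neg (by linarith) (by linarith)) ?_).2.differentiableAt
  · filter_upwards [ae_restrict_mem measurableSet_Ioi] with t ht w hw
    have ht : 0 < t := ht
    have hw : r.re / 2 < w.re := hw
    rw [← mul_assoc, norm_mul, norm_rpow_mul_cexp_neg ht, norm_neg, Complex.norm_real,
      Real.norm_of_nonneg ht.le, Real.rpow_add_one ht.ne', mul_right_comm]
    gcongr
  · refine Eventually.of_forall fun t w _ => ?_
    have h : HasDerivAt (fun w : ℂ => -(w * t)) (-(t : ℂ)) w := by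
      exact (hasDerivAt_mul_const (t : ℂ)).fun_neg
    exact h.cexp.const_mul _

lemma one_div_re_pos {r : ℂ} (hr : 0 < r.re) : 0 < (1 / r).re := by
  have h0 : r ≠ 0 := by rintro rfl; simp at hr
  rw [one_div, Complex.inv_re]
  exact div_pos hr (Complex.normSq_pos.2 h0)

/-- Both sides are analytic in r on the right half-plane and agree on the positive reals, which
accumulate at 1; the identity theorem does the rest. -/
lemma integral_rpow_mul_cexp_neg {γ : ℝ} (hγ : 0 < γ) {r : ℂ} (hr : 0 < r.re) :
    ∫ t in Ioi (0 : ℝ), ((t ^ (γ - 1) : ℝ) : ℂ) * Complex.exp (-(r * t)) =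
      (1 / r) ^ (γ : ℂ) * Real.Gamma γ := by
  have hopen : IsOpen {w : ℂ | 0 < w.re} := isOpen_lt continuous_const Complex.continuous_re
  have hf : AnalyticOnNhd ℂ (fun r : ℂ => ∫ t in Ioi (0 : ℝ),
      ((t ^ (γ - 1) : ℝ) : ℂ) * Complex.exp (-(r * t))) {w : ℂ | 0 < w.re} :=
    DifferentiableOn.analyticOnNhd (fun w hw => (differentiableAt_integral_rpow_mul_cexp_neg
      (by linarith) hw).differentiableWithinAt) hopen
  have hg : AnalyticOnNhd ℂ (fun r : ℂ => (1 / r) ^ (γ : ℂ) * (Real.Gamma γ : ℂ))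
      {w : ℂ | 0 < w.re} := by
    refine DifferentiableOn.analyticOnNhd (fun w hw => ?_) hopen
    have h0 : w ≠ 0 := by rintro rfl; simp at hw
    have h1 : DifferentiableAt ℂ (fun r : ℂ => 1 / r) w := by
      simpa using differentiableAt_inv h0
    exact ((h1.cpow_const (Or.inl (one_div_re_pos hw))).mul_const _).differentiableWithinAt
  refine hf.eqOn_of_preconnected_of_frequently_eq hg
    (convex_halfSpace_re_gt 0).isPreconnected (z₀ := 1) (by simp) ?_ hr
  have ht : Tendsto (fun x : ℝ => (x : ℂ)) (𝓝[≠] 1) (𝓝[≠] 1) := by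
    refine tendsto_nhdsWithin_iff.2 ⟨?_, ?_⟩
    · exact (Complex.continuous_ofReal.tendsto' 1 1 (by simp)).mono_left nhdsWithin_le_nhds
    · filter_upwards [self_mem_nhdsWithin] with x hx
      simpa using hx
  refine ht.frequently (Eventually.frequently ?_)
  filter_upwards [nhdsWithin_le_nhds (lt_mem_nhds (zero_lt_one (α := ℝ)))] with x hx
  rw [← Complex.Gamma_ofReal, ← Complex.integral_cpow_mul_exp_neg_mul_Ioi (by simpa using hγ) hx]
  refine setIntegral_congr_fun measurableSet_Ioi fun t ht => ?_
  rw [Complex.ofReal_cpow (le_of_lt ht)]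
  push_cast
  rfl

/-! ### Inverse Fourier integrals on the line -/

/-- The kernel `e^{2πiωx}`. -/
noncomputable def expKer (ω x : ℝ) : ℂ := Complex.exp ((2 * Real.pi * ω * x : ℝ) * Complex.I)

/-- The inverse Fourier integral `∫ e^{2πiωx} M(ω) dω`. -/
noncomputable def invF (M : ℝ → ℂ) (x : ℝ) : ℂ := ∫ ω, expKer ω x * M ω

lemma norm_expKer (ω x : ℝ) : ‖expKer ω x‖ = 1 := Complex.norm_exp_ofReal_mul_I _

lemma continuous_expKer : Continuous fun z : ℝ × ℝ => expKer z.1 z.2 := by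
  unfold expKer; fun_prop

@[fun_prop]
lemma continuous_expKer_left (x : ℝ) : Continuous fun ω => expKer ω x := by
  unfold expKer; fun_prop

@[fun_prop]
lemma continuous_expKer_right (ω : ℝ) : Continuous fun x => expKer ω x := by
  unfold expKer; fun_prop

lemma expKer_comm (ω x : ℝ) : expKer ω x = expKer x ω := by
  unfold expKer; congr 3; ring

lemma expKer_sub (ω x y : ℝ) :
    expKer ω (x - y) = expKer ω x * Complex.exp (-(2 * Real.pi * Complex.I * ω * y)) := by
  unfold expKer
  rw [← Complex.exp_add]
  congr 1
  push_cast
  ring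

lemma fourierInv_eq_invF (M : ℝ → ℂ) (x : ℝ) : 𝓕⁻ M x = invF M x := by
  rw [Real.fourierInv_eq']
  refine integral_congr_ae (Eventually.of_forall fun ω => ?_)
  simp only [expKer, smul_eq_mul, RCLike.inner_apply, conj_trivial]
  congr 2
  push_cast
  ring

lemma integrable_expKer_mul {M : ℝ → ℂ} (hM : Integrable M) (x : ℝ) :
    Integrable fun ω => expKer ω x * M ω :=
  hM.bdd_mul (c := 1) (continuous_expKer_left x).aestronglyMeasurable
    (Eventually.of_forall fun ω => (norm_expKer ω x).le)

lemma norm_invF_le (M : ℝ → ℂ) (x : ℝ) : ‖invF M x‖ ≤ ∫ ω, ‖M ω‖ := by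
  refine (norm_integral_le_integral_norm _).trans (le_of_eq ?_)
  simp [norm_expKer]

lemma continuous_invF {M : ℝ → ℂ} (hM : Integrable M) : Continuous (invF M) := by
  refine continuous_of_dominated (bound := fun ω => ‖M ω‖)
    (fun x => (integrable_expKer_mul hM x).aestronglyMeasurable)
    (fun x => Eventually.of_forall fun ω => ?_) hM.norm (Eventually.of_forall fun ω => ?_)
  · simp [norm_expKer]
  · fun_prop

lemma hasDerivAt_expKer (ω x : ℝ) :
    HasDerivAt (fun x => expKer ω x) (expKer ω x * (2 * Real.pi * Complex.I * ω)) x := by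
  have h : HasDerivAt (fun x : ℝ => ((2 * Real.pi * ω * x : ℝ) : ℂ) * Complex.I)
      (2 * Real.pi * Complex.I * ω) x := by
    have h1 : HasDerivAt (fun x : ℝ => 2 * Real.pi * ω * x) (2 * Real.pi * ω) x := by
      simpa using (hasDerivAt_id x).const_mul (2 * Real.pi * ω)
    have h2 := h1.ofReal_comp.mul_const Complex.I
    have e : ((2 * Real.pi * ω : ℝ) : ℂ) * Complex.I = 2 * Real.pi * Complex.I * ω := by
      push_cast; ring
    rwa [e] at h2
  exact h.cexp

lemma hasDerivAt_invF {M : ℝ → ℂ} (hM : Integrable M)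
    (hM' : Integrable fun ω : ℝ => (2 * Real.pi * Complex.I * ω) * M ω) (x : ℝ) :
    HasDerivAt (invF M) (invF (fun ω : ℝ => (2 * Real.pi * Complex.I * ω) * M ω) x) x := by
  refine (hasDerivAt_integral_of_dominated_loc_of_deriv_le
    (F' := fun x ω => expKer ω x * ((2 * Real.pi * Complex.I * ω) * M ω))
    (bound := fun ω : ℝ => ‖(2 * Real.pi * Complex.I * ω) * M ω‖) univ_mem
    (Eventually.of_forall fun w => (integrable_expKer_mul hM w).aestronglyMeasurable)
    (integrable_expKer_mul hM x) (integrable_expKer_mul hM' x).aestronglyMeasurable ?_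
    hM'.norm ?_).2
  · refine Eventually.of_forall fun ω y _ => ?_
    rw [norm_mul, norm_expKer, one_mul]
  · refine Eventually.of_forall fun ω y _ => ?_
    rw [← mul_assoc]
    exact (hasDerivAt_expKer ω y).mul_const _

/-- Fubini and the symmetry of the kernel. Pairing with test functions in this way gives injectivity
and inversion below. -/
lemma integral_mul_invF {φ M : ℝ → ℂ} (hφ : Integrable φ) (hM : Integrable M) :
    ∫ x, φ x * invF M x = ∫ ω, invF φ ω * M ω := by
  have hint : Integrable (fun z : ℝ × ℝ => φ z.1 * (expKer z.2 z.1 * M z.2))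
      (volume.prod volume) := by
    have h := (hφ.mul_prod hM).bdd_mul (c := 1)
      (continuous_expKer.aestronglyMeasurable) (Eventually.of_forall fun z => (norm_expKer _ _).le)
    refine h.congr (Eventually.of_forall fun z => ?_)
    simp only
    rw [expKer_comm]
    ring
  simp only [invF, ← integral_const_mul, ← integral_mul_const]
  rw [integral_integral_swap (f := fun x ω => φ x * (expKer ω x * M ω)) hint]
  refine integral_congr_ae (Eventually.of_forall fun ω => ?_)
  refine integral_congr_ae (Eventually.of_forall fun x => ?_)
  simp only
  rw [expKer_comm]
  ring

lemma exists_schwartz_invF {g : ℝ → ℝ} (hg : ContDiff ℝ ((⊤ : ℕ∞) : WithTop ℕ∞) g)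
    (hs : HasCompactSupport g) :
    ∃ φ : SchwartzMap ℝ ℂ, ∀ x, invF φ x = g x := by
  have hs' : HasCompactSupport fun x => (g x : ℂ) := hs.comp_left (g := Complex.ofReal) rfl
  let ψ : SchwartzMap ℝ ℂ := hs'.toSchwartzMap (Complex.ofRealCLM.contDiff.comp hg)
  refine ⟨𝓕 ψ, fun x => ?_⟩
  rw [← fourierInv_eq_invF, ← SchwartzMap.fourierInv_coe, FourierTransform.fourierInv_fourier_eq]
  rfl

/-- The inverse Fourier integral is injective on integrable functions. -/
lemma ae_eq_of_invF_eq {M N : ℝ → ℂ} (hM : Integrable M) (hN : Integrable N)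
    (h : ∀ x, invF M x = invF N x) : M =ᵐ[volume] N := by
  refine ae_eq_of_integral_contDiff_smul_eq hM.locallyIntegrable hN.locallyIntegrable
    fun g hg hs => ?_
  obtain ⟨φ, hφ⟩ := exists_schwartz_invF hg hs
  have h1 := integral_mul_invF φ.integrable hM
  have h2 := integral_mul_invF φ.integrable hN
  simp only [hφ, h] at h1 h2
  simp only [Complex.real_smul]
  rw [← h1, ← h2]

/-- Fourier inversion almost everywhere, without continuity. -/
lemma ae_eq_invF_fourier {f : ℝ → ℂ} (hf : Integrable f) (hf' : Integrable (𝓕 f)) :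
    f =ᵐ[volume] invF (𝓕 f) := by
  refine ae_eq_of_integral_contDiff_smul_eq hf.locallyIntegrable
    (continuous_invF hf').locallyIntegrable fun g hg hs => ?_
  have hs' : HasCompactSupport fun x => (g x : ℂ) := hs.comp_left (g := Complex.ofReal) rfl
  let ψ : SchwartzMap ℝ ℂ := hs'.toSchwartzMap (Complex.ofRealCLM.contDiff.comp hg)
  have hψ : ∀ x, ψ x = g x := fun x => rfl
  have h1 := integral_mul_invF ψ.integrable hf'
  -- The transform is moved from `f` onto the Schwartz function 𝓕⁻ψ, whose transform is ψ again.
  have h2 := VectorFourier.integral_fourierIntegral_smul_eq_flip (μ := volume) (ν := volume)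
    (L := innerₗ ℝ) (f := f) (g := fun x => (𝓕⁻ ψ : SchwartzMap ℝ ℂ) x)
    Real.continuous_fourierChar continuous_inner hf (𝓕⁻ ψ : SchwartzMap ℝ ℂ).integrable
  have h3 : ∀ x, VectorFourier.fourierIntegral Real.fourierChar volume (innerₗ ℝ).flip
      (fun x => (𝓕⁻ ψ : SchwartzMap ℝ ℂ) x) x = ψ x := by
    intro x
    rw [flip_innerₗ]
    have : 𝓕 (𝓕⁻ ψ : SchwartzMap ℝ ℂ) = ψ := FourierTransform.fourier_fourierInv_eq ψ
    conv_rhs => rw [← this, SchwartzMap.fourier_coe]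
    rfl
  simp only [h3] at h2
  have h4 : ∀ x, (𝓕⁻ ψ : SchwartzMap ℝ ℂ) x = invF ψ x := fun x => by
    rw [← fourierInv_eq_invF, SchwartzMap.fourierInv_coe]
  simp only [h4, hψ, smul_eq_mul] at h1 h2
  simp only [Complex.real_smul]
  rw [h1]
  calc ∫ x, (g x : ℂ) * f x = ∫ x, f x * (g x : ℂ) := by simp only [mul_comm]
    _ = _ := h2.symm
    _ = ∫ x, invF ψ x * 𝓕 f x := by
      refine integral_congr_ae (Eventually.of_forall fun x => mul_comm _ _)

/-! ### Backward differences -/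

/-- The Fourier multiplier of averaging over `[x - 1, x]`. -/
noncomputable def avgMult (ω : ℝ) : ℂ :=
  (1 - Complex.exp (-(2 * Real.pi * Complex.I * ω))) / (2 * Real.pi * Complex.I * ω)

lemma measurable_avgMult : Measurable avgMult := by unfold avgMult; fun_prop

/-- |e^(iθ) - 1| ≤ |θ|; at ω = 0 the quotient is 0 by convention. -/
lemma norm_avgMult_le (ω : ℝ) : ‖avgMult ω‖ ≤ 1 := by
  have h := Real.norm_exp_I_mul_ofReal_sub_one_le (x := -(2 * Real.pi * ω))
  rw [avgMult, norm_div, norm_sub_rev]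
  have e : Complex.I * ((-(2 * Real.pi * ω) : ℝ) : ℂ) = -(2 * Real.pi * Complex.I * ω) := by
    push_cast; ring
  rw [e] at h
  refine div_le_one_of_le₀ (h.trans (le_of_eq ?_)) (norm_nonneg _)
  simp

lemma integrable_avgMult_mul {M : ℝ → ℂ} (hM : Integrable M) :
    Integrable fun ω => avgMult ω * M ω :=
  hM.bdd_mul (c := 1) measurable_avgMult.aestronglyMeasurable
    (Eventually.of_forall norm_avgMult_le)

lemma two_pi_I_mul_ne_zero {ω : ℝ} (h : ω ≠ 0) : 2 * Real.pi * Complex.I * ω ≠ 0 := by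
  simp [h, Real.pi_ne_zero]

lemma integral_expKer {ω : ℝ} (hω : ω ≠ 0) (x : ℝ) :
    ∫ s in (x - 1)..x, expKer ω s = expKer ω x * avgMult ω := by
  have h0 := two_pi_I_mul_ne_zero hω
  have : ∀ s, expKer ω s = Complex.exp ((2 * Real.pi * Complex.I * ω) * s) := fun s => by
    unfold expKer; congr 1; push_cast; ring
  simp only [this]
  rw [integral_exp_mul_complex h0, avgMult, ← this, ← this, expKer_sub]
  push_cast
  ring_nf

lemma integral_invF {M : ℝ → ℂ} (hM : Integrable M) (x : ℝ) :
    ∫ s in (x - 1)..x, invF M s = invF (fun ω => avgMult ω * M ω) x := by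
  unfold invF
  rw [intervalIntegral_integral_swap]
  · refine integral_congr_ae ?_
    filter_upwards [Measure.ae_ne volume (0 : ℝ)] with ω hω
    rw [intervalIntegral.integral_mul_const, integral_expKer hω, mul_assoc]
  · have : IsFiniteMeasure (volume.restrict (uIoc (x - 1) x)) :=
      ⟨by simp [uIoc]⟩
    refine (hM.comp_snd _).bdd_mul (c := 1) ?_
      (Eventually.of_forall fun z => (norm_expKer z.2 z.1).le)
    exact (continuous_expKer.comp continuous_swap).aestronglyMeasurable

/-- The unit backward difference. -/
def bdiff (J : ℝ → ℂ) (x : ℝ) : ℂ := J x - J (x - 1)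

lemma hasDerivAt_bdiff {J J' : ℝ → ℂ} (h : ∀ x, HasDerivAt J (J' x) x) (x : ℝ) :
    HasDerivAt (bdiff J) (bdiff J' x) x :=
  (h x).sub ((h (x - 1)).comp_sub_const x 1)

lemma hasDerivAt_bdiff_iterate {J J' : ℝ → ℂ} (h : ∀ x, HasDerivAt J (J' x) x) (n : ℕ) (x : ℝ) :
    HasDerivAt (bdiff^[n] J) (bdiff^[n] J' x) x := by
  induction n generalizing J J' with
  | zero => exact h x
  | succ n ih => exact ih (hasDerivAt_bdiff h)

/-- Differencing kills the unknown constant of integration, so `bdiff J` is an inverse Fourier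
integral even when this is not known of `J`. -/
lemma bdiff_eq_of_hasDerivAt {J M : ℝ → ℂ} (hM : Integrable M)
    (h : ∀ x, HasDerivAt J (invF M x) x) (x : ℝ) :
    bdiff J x = invF (fun ω => avgMult ω * M ω) x := by
  rw [← integral_invF hM, intervalIntegral.integral_eq_sub_of_hasDerivAt (fun y _ => h y)
    ((continuous_invF hM).intervalIntegrable _ _)]
  rfl

lemma bdiff_invF {M : ℝ → ℂ} (hM : Integrable M) :
    bdiff (invF M) =
      invF (fun ω : ℝ => (1 - Complex.exp (-(2 * Real.pi * Complex.I * ω))) * M ω) := by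
  ext x
  rw [bdiff, invF, invF, ← integral_sub (integrable_expKer_mul hM _) (integrable_expKer_mul hM _)]
  refine integral_congr_ae (Eventually.of_forall fun ω => ?_)
  simp only [expKer_sub]
  push_cast
  ring_nf

/-- If `J` is an inverse Fourier integral of an integrable `G` and its fourth derivative is an
inverse Fourier integral of an integrable `F`, then `F = (2πiω)^4 G`. -/
lemma ae_eq_of_hasDerivAt_four {G F : ℝ → ℂ} (hG : Integrable G) (hF : Integrable F)
    {J₁ J₂ J₃ : ℝ → ℂ} (h0 : ∀ x, HasDerivAt (invF G) (J₁ x) x) (h1 : ∀ x, HasDerivAt J₁ (J₂ x) x)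
    (h2 : ∀ x, HasDerivAt J₂ (J₃ x) x) (h3 : ∀ x, HasDerivAt J₃ (invF F x) x) :
    ∀ᵐ ω : ℝ, F ω = (2 * Real.pi * Complex.I * ω) ^ 4 * G ω := by
  have i1 := integrable_avgMult_mul hF
  have i2 := integrable_avgMult_mul i1
  have i3 := integrable_avgMult_mul i2
  have i4 := integrable_avgMult_mul i3
  -- Each integration is paid for with one unit difference and one factor `avgMult`; after four, Δ^4
  -- applied to `invF G` has multiplier form `avgMult`^4 F.
  have e1 : bdiff J₃ = _ := funext (bdiff_eq_of_hasDerivAt hF h3)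
  have e2 : bdiff^[2] J₂ = _ := funext (bdiff_eq_of_hasDerivAt (J := bdiff J₂) i1 fun x => by
    rw [← e1]; exact hasDerivAt_bdiff h2 x)
  have e3 : bdiff^[3] J₁ = _ := funext (bdiff_eq_of_hasDerivAt (J := bdiff^[2] J₁) i2 fun x => by
    rw [← e2]; exact hasDerivAt_bdiff_iterate h1 2 x)
  have e4 := bdiff_eq_of_hasDerivAt (J := bdiff^[3] (invF G)) i3 fun x => by
    rw [← e3]; exact hasDerivAt_bdiff_iterate h0 3 x
  have hb : ∀ {M : ℝ → ℂ}, Integrable M → Integrable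
      (fun ω : ℝ => (1 - Complex.exp (-(2 * Real.pi * Complex.I * ω))) * M ω) := by
    intro M hM
    refine hM.bdd_mul (c := 2) (Continuous.aestronglyMeasurable (by fun_prop))
      (Eventually.of_forall fun ω => (norm_sub_le _ _).trans ?_)
    rw [Complex.norm_exp]
    norm_num
  simp only [Function.iterate_succ, Function.iterate_zero, Function.comp_apply, id_eq] at e4
  rw [bdiff_invF hG, bdiff_invF (hb hG), bdiff_invF (hb (hb hG)),
    bdiff_invF (hb (hb (hb hG)))] at e4
  -- Differencing `invF G` directly gives (1 - e^(-2πiω))^4 G. This factor vanishes only at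
  -- integers, a null set, and can be divided out.
  have key := ae_eq_of_invF_eq (hb (hb (hb (hb hG)))) i4 e4
  have hcount : {ω : ℝ | Complex.exp (-(2 * Real.pi * Complex.I * ω)) = 1}.Countable := by
    refine (countable_range (fun n : ℤ => (n : ℝ))).mono fun ω hω => ?_
    obtain ⟨n, hn⟩ := Complex.exp_eq_one_iff.1 hω
    refine ⟨-n, ?_⟩
    have h : (2 * Real.pi * Complex.I) * ((ω : ℂ) + n) = 0 := by linear_combination -hn
    have h' : (2 * Real.pi * Complex.I : ℂ) ≠ 0 := Complex.two_pi_I_ne_zero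
    have := (mul_eq_zero.1 h).resolve_left h'
    have h5 : ω + n = 0 := by exact_mod_cast this
    push_cast
    linarith
  filter_upwards [key, hcount.ae_notMem volume, Measure.ae_ne volume (0 : ℝ)] with ω hω h1 hω0
  have h0 := two_pi_I_mul_ne_zero hω0
  have hne : 1 - Complex.exp (-(2 * Real.pi * Complex.I * ω)) ≠ 0 := by
    rw [sub_ne_zero]; exact fun h => h1 h.symm
  have hm : avgMult ω * (2 * Real.pi * Complex.I * ω) =
      1 - Complex.exp (-(2 * Real.pi * Complex.I * ω)) := by
    rw [avgMult, div_mul_cancel₀ _ h0]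
  have hm0 : avgMult ω ≠ 0 := by
    intro h; rw [h, zero_mul] at hm; exact hne hm.symm
  simp only [← hm] at hω
  refine mul_left_cancel₀ (pow_ne_zero 4 hm0) ?_
  linear_combination -hω

/-! ### The fundamental theorem of calculus for absolutely continuous functions -/

/-- J - ∫f is absolutely continuous with derivative 0 almost everywhere, hence constant near x; so J
inherits the everywhere derivative of ∫f. -/
lemma hasDerivAt_of_absolutelyContinuous {J f : ℝ → ℂ}
    (hJ : ∀ a b, AbsolutelyContinuousOnInterval J a b) (hf : Continuous f)
    (h : deriv J =ᵐ[volume] f) (x : ℝ) : HasDerivAt J (f x) x := by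
  have hint : ∀ y, HasDerivAt (fun y => ∫ t in (0 : ℝ)..y, f t) (f y) y := fun y =>
    intervalIntegral.integral_hasDerivAt_right (hf.intervalIntegrable _ _)
      (hf.stronglyMeasurableAtFilter _ _) hf.continuousAt
  have hC1 : ContDiff ℝ 1 fun y => ∫ t in (0 : ℝ)..y, f t := by
    rw [contDiff_one_iff_deriv]
    refine ⟨fun y => (hint y).differentiableAt, ?_⟩
    rwa [show deriv (fun y => ∫ t in (0 : ℝ)..y, f t) = f from funext fun y => (hint y).deriv]
  have hg : ∀ a b, AbsolutelyContinuousOnInterval (fun y => J y - ∫ t in (0 : ℝ)..y, f t) a b :=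
    fun a b => (hJ a b).sub hC1.contDiffOn.absolutelyContinuousOnInterval
  obtain ⟨C, hC⟩ := (hg (x - 1) (x + 1)).const_of_ae_hasDerivAt_zero <| by
    filter_upwards [(hJ (x - 1) (x + 1)).boundedVariationOn.ae_differentiableAt_of_mem_uIcc, h]
      with y hy hyf hmem
    have := (hy hmem).hasDerivAt.sub (hint y)
    rwa [hyf, sub_self] at this
  have hev : J =ᶠ[𝓝 x] fun y => C + ∫ t in (0 : ℝ)..y, f t := by
    filter_upwards [Icc_mem_nhds (show x - 1 < x by linarith) (show x < x + 1 by linarith)]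
      with y hy
    have := hC y (by rwa [uIcc_of_le (by linarith)])
    rw [← this]; ring
  exact ((hint x).const_add C).congr_of_eventuallyEq hev

/-! ### The fractional integral as an inverse Fourier integral -/

lemma setIntegral_Iio_eq_Ioi (f : ℝ → ℂ) (x : ℝ) :
    ∫ ξ in Iio x, f ξ = ∫ t in Ioi 0, f (x - t) := by
  have h := (Measure.measurePreserving_sub_left volume x).setIntegral_preimage_emb
    (MeasurableEquiv.subLeft x).measurableEmbedding f (Iio x)
  rw [← h]
  congr 2
  ext t
  simp

lemma integrableOn_Ioi_comp_sub_left {f : ℝ → ℂ} {x : ℝ} (hf : IntegrableOn f (Iio x)) :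
    IntegrableOn (fun t => f (x - t)) (Ioi 0) := by
  have h := ((Measure.measurePreserving_sub_left volume x).integrableOn_comp_preimage
    (MeasurableEquiv.subLeft x).measurableEmbedding (f := f) (s := Iio x)).2 hf
  convert! h using 1
  ext t
  simp

lemma norm_one_div_two_pi_I_mul_cpow (γ ω : ℝ) :
    ‖(1 / (2 * Real.pi * Complex.I * ω)) ^ (γ : ℂ)‖ = (1 / (2 * Real.pi * |ω|)) ^ γ := by
  rw [Complex.norm_cpow_real]
  congr 1
  simp [abs_of_pos Real.pi_pos]

lemma integrableOn_abs_rpow {s : ℝ} (hs : -1 < s) :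
    IntegrableOn (fun ω : ℝ => |ω| ^ s) (Icc (-1) 1) := by
  have h0 : IntervalIntegrable (fun ω : ℝ => |ω| ^ s) volume 0 1 := by
    refine (intervalIntegral.intervalIntegrable_rpow' hs (a := 0) (b := 1)).congr
      fun ω hω => ?_
    rw [uIoc_of_le zero_le_one] at hω
    simp only [abs_of_pos hω.1]
  have h1 : IntervalIntegrable (fun ω : ℝ => |ω| ^ s) volume (-1) 0 := by
    have := (IntervalIntegrable.iff_comp_neg (by simp)).1 h0
    simpa using this.symm
  exact (intervalIntegrable_iff_integrableOn_Icc_of_le (by norm_num)).1 (h1.trans h0)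

/-- A bounded integrable function stays integrable after division by `(2πiω)^γ`, `0 < γ < 1`. -/
lemma integrable_one_div_rpow_mul {γ : ℝ} (hγ : γ ∈ Ioo (0 : ℝ) 1) {M : ℝ → ℂ} {B : ℝ}
    (hM : Integrable M) (hB : ∀ ω, ‖M ω‖ ≤ B) :
    Integrable fun ω : ℝ => (1 / (2 * Real.pi * |ω|)) ^ γ * ‖M ω‖ := by
  have hB0 : 0 ≤ B := (norm_nonneg _).trans (hB 0)
  have hπ := Real.pi_gt_three
  -- Near 0, M is bounded and |ω|^(-γ) is integrable as γ < 1; for |ω| ≥ 1 the power is at most 1.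
  have hind : Integrable ((Icc (-1 : ℝ) 1).indicator fun ω : ℝ => |ω| ^ (-γ) * B) :=
    (integrable_indicator_iff measurableSet_Icc).2
      ((integrableOn_abs_rpow (by linarith [hγ.2])).mul_const B)
  refine (hind.add hM.norm).mono' ?_ (Eventually.of_forall fun ω => ?_)
  · exact (Measurable.aestronglyMeasurable (by fun_prop)).mul hM.norm.aestronglyMeasurable
  have hle : (1 / (2 * Real.pi * |ω|)) ^ γ ≤ |ω| ^ (-γ) := by
    rw [Real.rpow_neg (abs_nonneg _), ← Real.inv_rpow (abs_nonneg _)]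
    refine Real.rpow_le_rpow (by positivity) ?_ hγ.1.le
    rw [one_div, mul_inv]
    exact mul_le_of_le_one_left (by positivity) (inv_le_one_of_one_le₀ (by linarith))
  rw [Real.norm_of_nonneg (by positivity), Pi.add_apply]
  by_cases hω : ω ∈ Icc (-1 : ℝ) 1
  · rw [indicator_of_mem hω]
    have : (1 / (2 * Real.pi * |ω|)) ^ γ * ‖M ω‖ ≤ |ω| ^ (-γ) * B := by gcongr; exact hB ω
    linarith [norm_nonneg (M ω)]
  · rw [indicator_of_notMem hω, zero_add]
    have h1 : 1 ≤ |ω| := by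
      by_contra! hc
      exact hω (abs_le.1 hc.le)
    refine mul_le_of_le_one_left (norm_nonneg _) (hle.trans ?_)
    exact Real.rpow_le_one_of_one_le_of_nonpos h1 (by linarith [hγ.1])

lemma aestronglyMeasurable_cpow_mul {M : ℝ → ℂ} (hM : Integrable M) (γ ε : ℝ) :
    AEStronglyMeasurable
      (fun ω : ℝ => (1 / (ε + 2 * Real.pi * Complex.I * ω)) ^ (γ : ℂ) * M ω) volume :=
  (Measurable.aestronglyMeasurable (by fun_prop)).mul hM.aestronglyMeasurable

lemma integrable_cpow_mul {γ : ℝ} (hγ : γ ∈ Ioo (0 : ℝ) 1) {M : ℝ → ℂ} {B : ℝ}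
    (hM : Integrable M) (hB : ∀ ω, ‖M ω‖ ≤ B) :
    Integrable fun ω : ℝ => (1 / (2 * Real.pi * Complex.I * ω)) ^ (γ : ℂ) * M ω := by
  refine (integrable_one_div_rpow_mul hγ hM hB).mono' ?_ (Eventually.of_forall fun ω => ?_)
  · simpa using aestronglyMeasurable_cpow_mul hM γ 0
  · rw [norm_mul, norm_one_div_two_pi_I_mul_cpow]

/-- The exponentially damped fractional integral of an inverse Fourier integral. -/
lemma integral_damped {γ ε : ℝ} (hγ : 0 < γ) (hε : 0 < ε) {M : ℝ → ℂ} (hM : Integrable M)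
    (x : ℝ) :
    ∫ t in Ioi (0 : ℝ), ((t ^ (γ - 1) : ℝ) : ℂ) * Complex.exp (-(ε * t)) * invF M (x - t) =
      Real.Gamma γ *
        invF (fun ω => (1 / (ε + 2 * Real.pi * Complex.I * ω)) ^ (γ : ℂ) * M ω) x := by
  -- The damping e^(-εt) makes t^(γ-1) integrable on the half-line, which Fubini needs.
  have hint : Integrable (fun z : ℝ × ℝ => ((z.1 ^ (γ - 1) : ℝ) : ℂ) *
      Complex.exp (-(ε * z.1)) * (expKer z.2 (x - z.1) * M z.2))
      ((volume.restrict (Ioi 0)).prod volume) := by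
    have h := ((integrableOn_rpow_mul_cexp_neg (s := γ - 1) (r := ε) (by linarith)
      (by simpa using hε)).mul_prod hM).bdd_mul (c := 1) (f := fun z : ℝ × ℝ =>
        expKer z.2 (x - z.1)) ?_ (Eventually.of_forall fun z => (norm_expKer _ _).le)
    · refine h.congr (Eventually.of_forall fun z => ?_)
      simp only
      ring
    · exact (continuous_expKer.comp (by fun_prop :
        Continuous fun z : ℝ × ℝ => (z.2, x - z.1))).aestronglyMeasurable
  simp only [invF, ← integral_const_mul]
  rw [integral_integral_swap (f := fun t ω => ((t ^ (γ - 1) : ℝ) : ℂ) *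
      Complex.exp (-(ε * t)) * (expKer ω (x - t) * M ω)) hint]
  refine integral_congr_ae (Eventually.of_forall fun ω => ?_)
  have hr : 0 < ((ε : ℂ) + 2 * Real.pi * Complex.I * ω).re := by simpa using hε
  have key := integral_rpow_mul_cexp_neg hγ hr
  simp only
  calc _ = ∫ t in Ioi (0 : ℝ), (expKer ω x * M ω) * (((t ^ (γ - 1) : ℝ) : ℂ) *
        Complex.exp (-((ε + 2 * Real.pi * Complex.I * ω) * t))) := by
        refine integral_congr_ae (Eventually.of_forall fun t => ?_)
        simp only [expKer_sub]
        have : -(((ε : ℂ) + 2 * Real.pi * Complex.I * ω) * t) =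
          -(ε * t) + -(2 * Real.pi * Complex.I * ω * t) := by ring
        rw [this, Complex.exp_add]
        ring
    _ = _ := by
        rw [integral_const_mul, key]
        ring

lemma tendsto_one_div_add_cpow (γ : ℝ) {ω : ℝ} (hω : ω ≠ 0) :
    Tendsto (fun ε : ℝ => (1 / ((ε : ℂ) + 2 * Real.pi * Complex.I * ω)) ^ (γ : ℂ)) (𝓝[>] 0)
      (𝓝 ((1 / (2 * Real.pi * Complex.I * ω)) ^ (γ : ℂ))) := by
  have h0 := two_pi_I_mul_ne_zero hω
  have hc : ContinuousAt (fun ε : ℝ => (1 / ((ε : ℂ) + 2 * Real.pi * Complex.I * ω)) ^ (γ : ℂ))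
      0 := by
    refine ContinuousAt.cpow ?_ continuousAt_const ?_
    · refine continuousAt_const.div (by fun_prop) ?_
      simpa using h0
    · right
      simp [Real.pi_ne_zero, hω]
  have := hc.tendsto.mono_left (nhdsWithin_le_nhds (s := Ioi 0))
  simpa using this

/-- The fractional integral of `u = invF M` is the inverse Fourier integral of
`(2πiω)^{-γ} M(ω)`. -/
lemma rlIntegral_eq_invF {γ : ℝ} (hγ : γ ∈ Ioo (0 : ℝ) 1) {M : ℝ → ℂ} {B : ℝ}
    (hM : Integrable M) (hB : ∀ ω, ‖M ω‖ ≤ B) {x : ℝ}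
    (hx : IntegrableOn (fun ξ => ((x - ξ) ^ (γ - 1) : ℝ) • invF M ξ) (Iio x)) :
    rlIntegral γ (invF M) x =
      invF (fun ω => (1 / (2 * Real.pi * Complex.I * ω)) ^ (γ : ℂ) * M ω) x := by
  have hΓ := Real.Gamma_pos_of_pos hγ.1
  have hx' : IntegrableOn (fun t => ((t ^ (γ - 1) : ℝ) : ℂ) * invF M (x - t)) (Ioi 0) := by
    simpa using integrableOn_Ioi_comp_sub_left hx
  -- Let ε → 0+ in `integral_damped`. On this side the absolutely convergent undamped integrand
  -- dominates.
  have l1 : Tendsto (fun ε : ℝ => ∫ t in Ioi (0 : ℝ),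
      ((t ^ (γ - 1) : ℝ) : ℂ) * Complex.exp (-(ε * t)) * invF M (x - t)) (𝓝[>] 0)
      (𝓝 (∫ t in Ioi (0 : ℝ), ((t ^ (γ - 1) : ℝ) : ℂ) * invF M (x - t))) := by
    refine tendsto_integral_filter_of_dominated_convergence
      (fun t => ‖((t ^ (γ - 1) : ℝ) : ℂ) * invF M (x - t)‖) (Eventually.of_forall fun ε => ?_)
      ?_ hx'.norm (Eventually.of_forall fun t => ?_)
    · exact (aestronglyMeasurable_rpow_mul_cexp_neg _ _ _).mul
        ((continuous_invF hM).comp (by fun_prop)).aestronglyMeasurable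
    · filter_upwards [self_mem_nhdsWithin] with ε hε
      filter_upwards [ae_restrict_mem measurableSet_Ioi] with t ht
      rw [mul_right_comm, norm_mul]
      refine mul_le_of_le_one_right (norm_nonneg _) ?_
      have h1 : 0 ≤ ε * t := (mul_pos (mem_Ioi.1 hε) (mem_Ioi.1 ht)).le
      rw [Complex.norm_exp]
      simpa using h1
    · have hc : Continuous fun ε : ℝ => ((t ^ (γ - 1) : ℝ) : ℂ) * Complex.exp (-(ε * t)) *
        invF M (x - t) := by fun_prop
      have := (hc.tendsto 0).mono_left (nhdsWithin_le_nhds (s := Ioi 0))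
      simpa using this
  have l2 : Tendsto (fun ε : ℝ => (Real.Gamma γ : ℂ) *
      invF (fun ω => (1 / ((ε : ℂ) + 2 * Real.pi * Complex.I * ω)) ^ (γ : ℂ) * M ω) x) (𝓝[>] 0)
      (𝓝 (Real.Gamma γ *
        invF (fun ω => (1 / (2 * Real.pi * Complex.I * ω)) ^ (γ : ℂ) * M ω) x)) := by
    refine Tendsto.const_mul _ ?_
    refine tendsto_integral_filter_of_dominated_convergence
      (fun ω : ℝ => (1 / (2 * Real.pi * |ω|)) ^ γ * ‖M ω‖) (Eventually.of_forall fun ε => ?_)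
      (Eventually.of_forall fun ε => ?_) (integrable_one_div_rpow_mul hγ hM hB) ?_
    · exact (continuous_expKer_left x).aestronglyMeasurable.mul
        (aestronglyMeasurable_cpow_mul hM γ ε)
    · filter_upwards [Measure.ae_ne volume (0 : ℝ)] with ω hω
      have hω' : 0 < |ω| := abs_pos.2 hω
      rw [norm_mul, norm_mul, norm_expKer, one_mul, Complex.norm_cpow_real, norm_div, norm_one]
      -- Since |ε + 2πiω| ≥ 2π|ω|, the undamped multiplier dominates uniformly in ε.
      have him := Complex.abs_im_le_norm ((ε : ℂ) + 2 * Real.pi * Complex.I * ω)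
      have hime : |((ε : ℂ) + 2 * Real.pi * Complex.I * ω).im| = 2 * Real.pi * |ω| := by
        simp [abs_mul, abs_of_pos Real.pi_pos]
      rw [hime] at him
      have hpos : 0 < 2 * Real.pi * |ω| := by positivity
      gcongr
      exact hγ.1.le
    · filter_upwards [Measure.ae_ne volume (0 : ℝ)] with ω hω
      exact ((tendsto_one_div_add_cpow γ hω).mul_const _).const_mul _
  have l3 := tendsto_nhds_unique l1 (l2.congr' <| by
    filter_upwards [self_mem_nhdsWithin] with ε hε
    rw [integral_damped hγ.1 hε hM])
  rw [rlIntegral, setIntegral_Iio_eq_Ioi]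
  simp only [sub_sub_cancel, Complex.real_smul]
  rw [l3]
  push_cast
  have : (Real.Gamma γ : ℂ) ≠ 0 := by exact_mod_cast hΓ.ne'
  field_simp

lemma sq_mul_one_div_cpow {α : ℝ} (hα : α ≠ 0) (ω : ℝ) :
    (2 * Real.pi * Complex.I * ω) ^ 2 *
      (1 / (2 * Real.pi * Complex.I * ω)) ^ ((2 - α : ℝ) : ℂ) =
      (2 * Real.pi * Complex.I * ω) ^ (α : ℂ) := by
  rcases eq_or_ne ω 0 with rfl | hω
  · have : (α : ℂ) ≠ 0 := by exact_mod_cast hα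
    simp [Complex.zero_cpow this]
  have h0 := two_pi_I_mul_ne_zero hω
  have harg : (2 * Real.pi * Complex.I * ω).arg ≠ Real.pi := by
    refine Complex.slitPlane_arg_ne_pi (Or.inr ?_)
    simp [Real.pi_ne_zero, hω]
  rw [one_div, Complex.inv_cpow _ _ harg, ← Complex.cpow_neg, ← Complex.cpow_two,
    ← Complex.cpow_add _ _ h0]
  congr 1
  push_cast
  ring

lemma norm_two_pi_I_mul (ω : ℝ) : ‖(2 * Real.pi * Complex.I * ω : ℂ)‖ = 2 * Real.pi * |ω| := by
  simp [abs_of_pos Real.pi_pos]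

/-! ### The shifted Lubich operator on the Fourier side -/

lemma exp_shift_eq (h : ℝ) (r : ℤ) (k : ℕ) (ω x : ℝ) :
    expKer ω (x - ((k : ℝ) - (r : ℝ)) * h) = expKer ω x *
      (Complex.exp (r * (2 * Real.pi * Complex.I * ω * h)) *
        Complex.exp (-(2 * Real.pi * Complex.I * ω * h)) ^ k) := by
  rw [expKer_sub, ← Complex.exp_nat_mul, ← Complex.exp_add]
  congr 2
  push_cast
  ring

lemma summable_qCoeff_smul {α : ℝ} (hα : α ∈ Ioo (1 : ℝ) 2) (M : ℝ → ℂ) (y : ℕ → ℝ) :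
    Summable fun k => qCoeff α k • invF M (y k) := by
  refine Summable.of_norm_bounded ((summable_norm_qCoeff hα).mul_right (∫ ω, ‖M ω‖)) fun k => ?_
  rw [norm_smul]
  gcongr
  exact norm_invF_le _ _

/-- A shift by (k - r)h multiplies by e^(rz) e^(-kz); summing under the integral is allowed because
the q_k are absolutely summable. -/
lemma tsum_lubich {α : ℝ} (hα : α ∈ Ioo (1 : ℝ) 2) (h : ℝ) (r : ℤ) {M : ℝ → ℂ}
    (hM : Integrable M) (x : ℝ) :
    ∑' k : ℕ, qCoeff α k • invF M (x - ((k : ℝ) - (r : ℝ)) * h) =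
      ∫ ω, expKer ω x * (Complex.exp (r * (2 * Real.pi * Complex.I * ω * h)) *
        (∑' k, (qCoeff α k : ℂ) * Complex.exp (-(2 * Real.pi * Complex.I * ω * h)) ^ k) *
          M ω) := by
  have hint : ∀ k : ℕ, Integrable fun ω => (qCoeff α k : ℂ) *
      (expKer ω (x - ((k : ℝ) - (r : ℝ)) * h) * M ω) := fun k =>
    (integrable_expKer_mul hM _).const_mul _
  have hs : Summable fun k => ∫ ω, ‖(qCoeff α k : ℂ) *
      (expKer ω (x - ((k : ℝ) - (r : ℝ)) * h) * M ω)‖ := by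
    simp only [norm_mul, norm_expKer, one_mul, integral_const_mul, Complex.norm_real]
    exact (summable_norm_qCoeff hα).mul_right _
  have key := (hasSum_integral_of_summable_integral_norm hint hs).tsum_eq
  simp only [integral_const_mul] at key
  simp only [Complex.real_smul]
  refine key.trans (integral_congr_ae (Eventually.of_forall fun ω => ?_))
  simp only [exp_shift_eq]
  rw [← tsum_mul_left, ← tsum_mul_right, ← tsum_mul_left]
  refine tsum_congr fun k => ?_
  ring

/-- Taken with γ = 2 - α and β = α + 2, this is the moment of the transform that bounds the error.
-/
lemma integrable_rpow_mul_of_fourth_moment {β γ : ℝ} (hβγ : β + γ = 4) {M N : ℝ → ℂ}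
    (hM : Integrable M) (hN : Integrable N)
    (h : ∀ᵐ ω : ℝ, N ω = (2 * Real.pi * Complex.I * ω) ^ 4 *
      ((1 / (2 * Real.pi * Complex.I * ω)) ^ (γ : ℂ) * M ω)) :
    Integrable fun ω : ℝ => (2 * Real.pi * |ω|) ^ β * ‖M ω‖ := by
  have hm : AEStronglyMeasurable (fun ω : ℝ => (2 * Real.pi * |ω|) ^ β * ‖M ω‖) volume :=
    (Measurable.aestronglyMeasurable (by fun_prop)).mul hM.norm.aestronglyMeasurable
  refine hN.norm.mono' hm ?_
  filter_upwards [h, Measure.ae_ne volume (0 : ℝ)] with ω hω hω0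
  have hpos : 0 < 2 * Real.pi * |ω| := by positivity
  rw [Real.norm_of_nonneg (by positivity), hω, norm_mul, norm_mul, norm_pow, norm_two_pi_I_mul,
    norm_one_div_two_pi_I_mul_cpow, ← mul_assoc]
  refine le_of_eq ?_
  congr 1
  rw [one_div, Real.inv_rpow hpos.le, ← Real.rpow_neg hpos.le, ← Real.rpow_natCast,
    ← Real.rpow_add hpos]
  congr 1
  push_cast
  linarith

lemma integrable_pow_mul_of_fourth_moment {G : ℝ → ℂ} (hG : Integrable G)
    (h4 : Integrable fun ω : ℝ => (2 * Real.pi * Complex.I * ω) ^ 4 * G ω) {j : ℕ} (hj : j ≤ 4) :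
    Integrable fun ω : ℝ => (2 * Real.pi * Complex.I * ω) ^ j * G ω := by
  refine (hG.norm.add h4.norm).mono' ?_ (Eventually.of_forall fun ω => ?_)
  · exact (Continuous.aestronglyMeasurable (by fun_prop)).mul hG.aestronglyMeasurable
  rw [Pi.add_apply, norm_mul, norm_mul, norm_pow, norm_pow]
  set s := ‖(2 * Real.pi * Complex.I * ω : ℂ)‖
  have hs : 0 ≤ s := norm_nonneg _
  have h : s ^ j ≤ 1 + s ^ 4 := by
    rcases le_total s 1 with h | h
    · linarith [pow_le_one₀ (n := j) hs h, pow_nonneg hs 4]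
    · linarith [pow_le_pow_right₀ h hj]
  calc _ ≤ (1 + s ^ 4) * ‖G ω‖ := by gcongr
    _ = _ := by ring

/-- The symbol of the step-`h` operator, with the common factor `û` removed. -/
lemma exists_scaled_symbol_bound {α : ℝ} (hα : α ∈ Ioo (1 : ℝ) 2) {p q : ℤ} (hpq : p ≠ q) :
    ∃ C : ℝ, ∀ h : ℝ, 0 < h → ∀ ω : ℝ,
      ‖(2 * Real.pi * Complex.I * ω) ^ (α : ℂ) - ((1 / h ^ α : ℝ) : ℂ) *
        (((((q : ℝ) / ((q : ℝ) - p) : ℝ) : ℂ) *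
            Complex.exp (p * (2 * Real.pi * Complex.I * ω * h)) +
          (((p : ℝ) / ((p : ℝ) - q) : ℝ) : ℂ) *
            Complex.exp (q * (2 * Real.pi * Complex.I * ω * h))) *
          ∑' k, (qCoeff α k : ℂ) * Complex.exp (-(2 * Real.pi * Complex.I * ω * h)) ^ k)‖ ≤
        C * h ^ 2 * (2 * Real.pi * |ω|) ^ (α + 2) := by
  obtain ⟨C, hC⟩ := exists_symbol_bound hα hpq
  refine ⟨C, fun h hh ω => ?_⟩
  have hα0 : (α : ℂ) ≠ 0 := by exact_mod_cast (by linarith [hα.1] : (0 : ℝ) < α).ne'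
  have hhα : 0 < h ^ α := Real.rpow_pos_of_pos hh α
  -- Take z = 2πiωh; after division by h^α, the factor h^(α+2) leaves h^2.
  have key := hC (2 * Real.pi * Complex.I * ω * h) (by simp)
  set S := ((((q : ℝ) / ((q : ℝ) - p) : ℝ) : ℂ) *
            Complex.exp (p * (2 * Real.pi * Complex.I * ω * h)) +
          (((p : ℝ) / ((p : ℝ) - q) : ℝ) : ℂ) *
            Complex.exp (q * (2 * Real.pi * Complex.I * ω * h))) *
          ∑' k, (qCoeff α k : ℂ) * Complex.exp (-(2 * Real.pi * Complex.I * ω * h)) ^ k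
  have hnorm : ‖(2 * Real.pi * Complex.I * ω * h : ℂ)‖ = h * (2 * Real.pi * |ω|) := by
    rw [norm_mul, norm_two_pi_I_mul, Complex.norm_real, Real.norm_of_nonneg hh.le, mul_comm]
  rw [mul_comm _ (h : ℂ), ofReal_mul_cpow hh _ hα0, mul_comm (h : ℂ), hnorm,
    ← Complex.ofReal_cpow hh.le] at key
  have e : (2 * Real.pi * Complex.I * ω) ^ (α : ℂ) - ((1 / h ^ α : ℝ) : ℂ) * S =
      -(((1 / h ^ α : ℝ) : ℂ) * (S - (h ^ α : ℝ) * (2 * Real.pi * Complex.I * ω) ^ (α : ℂ))) := by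
    have : ((h ^ α : ℝ) : ℂ) ≠ 0 := by exact_mod_cast hhα.ne'
    push_cast [Complex.ofReal_div]
    field_simp
    ring
  rw [e, norm_neg, norm_mul, Complex.norm_real, Real.norm_of_nonneg (by positivity)]
  calc _ ≤ 1 / h ^ α * (C * (h * (2 * Real.pi * |ω|)) ^ (α + 2)) := by gcongr
    _ = _ := by
      rw [Real.mul_rpow hh.le (by positivity), Real.rpow_add hh, Real.rpow_two]
      field_simp

lemma integrable_expKer_symbol {α : ℝ} (hα : α ∈ Ioo (1 : ℝ) 2) (h : ℝ) (r : ℤ) {M : ℝ → ℂ}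
    (hM : Integrable M) (x : ℝ) :
    Integrable fun ω => expKer ω x * (Complex.exp (r * (2 * Real.pi * Complex.I * ω * h)) *
        (∑' k, (qCoeff α k : ℂ) * Complex.exp (-(2 * Real.pi * Complex.I * ω * h)) ^ k) *
          M ω) := by
  have hn : ∀ ω : ℝ, ‖Complex.exp (-(2 * Real.pi * Complex.I * ω * h))‖ = 1 := fun ω => by
    simp [Complex.norm_exp]
  have hc : Continuous fun ω : ℝ =>
      ∑' k, (qCoeff α k : ℂ) * Complex.exp (-(2 * Real.pi * Complex.I * ω * h)) ^ k := by
    refine continuous_tsum (fun k => by fun_prop) (summable_norm_qCoeff hα) fun k ω => ?_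
    rw [norm_mul, norm_pow, hn, one_pow, mul_one, Complex.norm_real]
  refine integrable_expKer_mul (hM.bdd_mul (c := ∑' k, ‖qCoeff α k‖)
    ((Continuous.mul (by fun_prop) hc).aestronglyMeasurable)
    (Eventually.of_forall fun ω => ?_)) x
  have h1 : ‖Complex.exp (r * (2 * Real.pi * Complex.I * ω * h))‖ = 1 := by
    simp [Complex.norm_exp]
  rw [Pi.mul_apply, norm_mul, h1, one_mul]
  exact norm_tsum_qCoeff_le hα (hn ω).le

lemma wsld2_eq_integral {α : ℝ} (hα : α ∈ Ioo (1 : ℝ) 2) (h : ℝ) (p q : ℤ) {M : ℝ → ℂ}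
    (hM : Integrable M) (x : ℝ) :
    wsld2 α h p q (invF M) x = ∫ ω, expKer ω x * (((1 / h ^ α : ℝ) : ℂ) *
        (((((q : ℝ) / ((q : ℝ) - p) : ℝ) : ℂ) *
            Complex.exp (p * (2 * Real.pi * Complex.I * ω * h)) +
          (((p : ℝ) / ((p : ℝ) - q) : ℝ) : ℂ) *
            Complex.exp (q * (2 * Real.pi * Complex.I * ω * h))) *
          ∑' k, (qCoeff α k : ℂ) * Complex.exp (-(2 * Real.pi * Complex.I * ω * h)) ^ k) *
            M ω) := by
  have hp := integrable_expKer_symbol hα h p hM x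
  have hq := integrable_expKer_symbol hα h q hM x
  rw [wsld2, lubich, lubich, tsum_lubich hα h p hM, tsum_lubich hα h q hM]
  simp only [Complex.real_smul, ← integral_const_mul]
  rw [← integral_add ((hp.const_mul _).const_mul _) ((hq.const_mul _).const_mul _)]
  refine integral_congr_ae (Eventually.of_forall fun ω => ?_)
  simp only
  ring

/-- Second order consistency on the Fourier side. -/
lemma exists_norm_invF_sub_wsld2_le {α : ℝ} (hα : α ∈ Ioo (1 : ℝ) 2) {p q : ℤ} (hpq : p ≠ q)
    {M : ℝ → ℂ} (hM : Integrable M)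
    (hMα : Integrable fun ω : ℝ => (2 * Real.pi * Complex.I * ω) ^ (α : ℂ) * M ω)
    (hM' : Integrable fun ω : ℝ => (2 * Real.pi * |ω|) ^ (α + 2) * ‖M ω‖) :
    ∃ C : ℝ, ∀ h : ℝ, 0 < h → ∀ x : ℝ,
      ‖invF (fun ω : ℝ => (2 * Real.pi * Complex.I * ω) ^ (α : ℂ) * M ω) x -
        wsld2 α h p q (invF M) x‖ ≤ C * h ^ 2 := by
  obtain ⟨C, hC⟩ := exists_scaled_symbol_bound hα hpq
  refine ⟨C * ∫ ω : ℝ, (2 * Real.pi * |ω|) ^ (α + 2) * ‖M ω‖, fun h hh x => ?_⟩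
  have hint : Integrable fun ω : ℝ => expKer ω x * (((1 / h ^ α : ℝ) : ℂ) *
        (((((q : ℝ) / ((q : ℝ) - p) : ℝ) : ℂ) *
            Complex.exp (p * (2 * Real.pi * Complex.I * ω * h)) +
          (((p : ℝ) / ((p : ℝ) - q) : ℝ) : ℂ) *
            Complex.exp (q * (2 * Real.pi * Complex.I * ω * h))) *
          ∑' k, (qCoeff α k : ℂ) * Complex.exp (-(2 * Real.pi * Complex.I * ω * h)) ^ k) *
            M ω) := by
    refine ((((integrable_expKer_symbol hα h p hM x).const_mul
      (((q : ℝ) / ((q : ℝ) - p) : ℝ) : ℂ)).add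
      ((integrable_expKer_symbol hα h q hM x).const_mul
        (((p : ℝ) / ((p : ℝ) - q) : ℝ) : ℂ))).const_mul ((1 / h ^ α : ℝ) : ℂ)).congr
      (Eventually.of_forall fun ω => ?_)
    simp only [Pi.add_apply]
    ring
  rw [wsld2_eq_integral hα h p q hM, invF, ← integral_sub (integrable_expKer_mul hMα x) hint]
  calc _ ≤ ∫ ω : ℝ, C * h ^ 2 * ((2 * Real.pi * |ω|) ^ (α + 2) * ‖M ω‖) := by
        refine norm_integral_le_of_norm_le (hM'.const_mul _) (Eventually.of_forall fun ω => ?_)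
        rw [← mul_sub, ← sub_mul, norm_mul, norm_expKer, one_mul, norm_mul, ← mul_assoc (C * h ^ 2)]
        exact mul_le_mul_of_nonneg_right (hC h hh ω) (norm_nonneg (M ω))
    _ = _ := by rw [integral_const_mul]; ring

end WSLD

open WSLD in
theorem theorem2p1 (α : ℝ) (hα : α ∈ Ioo (1 : ℝ) 2) (p q : ℤ) (hpq : p ≠ q)
    (u : ℝ → ℂ) (hu_cont : Continuous u)
    (hu : Integrable u) (hu_hat : Integrable (𝓕 u))
    (hD_exists : HasRLDeriv (α + 2) u)
    (hD : Integrable (rlDeriv (α + 2) u))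
    (hD_hat : Integrable (𝓕 (rlDeriv (α + 2) u))) :
    HasRLDeriv α u ∧ ContDiff ℝ 2 (rlIntegral (2 - α) u) ∧
    ∃ C : ℝ, ∀ h : ℝ, 0 < h → ∀ x : ℝ,
      Summable (fun k : ℕ => qCoeff α k • u (x - ((k : ℝ) - (p : ℝ)) * h)) ∧
      Summable (fun k : ℕ => qCoeff α k • u (x - ((k : ℝ) - (q : ℝ)) * h)) ∧
      ‖rlDeriv α u x - wsld2 α h p q u x‖ ≤ C * h ^ 2 := by
  have hα0 : α ≠ 0 := by linarith [hα.1]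
  have hγ : 2 - α ∈ Ioo (0 : ℝ) 1 := ⟨by linarith [hα.2], by linarith [hα.1]⟩
  have hfl : ⌊α⌋₊ = 1 := by
    rw [Nat.floor_eq_iff (by linarith [hα.1])]
    exact ⟨by exact_mod_cast hα.1.le, by norm_num; exact hα.2⟩
  have hfl2 : ⌊α + 2⌋₊ = 3 := by
    rw [Nat.floor_add_ofNat (by linarith [hα.1]), hfl]
  -- The derivatives of orders α and α + 2 rest on the same fractional integral, of order 2 - α,
  -- differentiated two and four times.
  have hord : (((⌊α⌋₊ + 1 : ℕ) : ℝ) - α) = 2 - α := by rw [hfl]; norm_num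
  have hord2 : (((⌊α + 2⌋₊ + 1 : ℕ) : ℝ) - (α + 2)) = 2 - α := by
    rw [hfl2]; push_cast; ring
  obtain ⟨hint, hcd, hac⟩ := hD_exists
  simp only [hord2] at hint hcd hac
  simp only [hfl2] at hcd hac
  have hrl : rlDeriv (α + 2) u = iteratedDeriv (3 + 1) (rlIntegral (2 - α) u) := by
    ext x
    rw [rlDeriv, hord2, hfl2]
  rw [hrl] at hD hD_hat
  have hcd2 : ContDiff ℝ 2 (rlIntegral (2 - α) u) := hcd.of_le (by norm_num)
  have hdiff : ∀ j : ℕ, j < 3 → ∀ x, HasDerivAt (iteratedDeriv j (rlIntegral (2 - α) u))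
      (iteratedDeriv (j + 1) (rlIntegral (2 - α) u) x) x := by
    intro j hj x
    rw [iteratedDeriv_succ]
    exact (hcd.differentiable_iteratedDeriv j (by exact_mod_cast hj) x).hasDerivAt
  refine ⟨⟨?_, ?_, ?_⟩, hcd2, ?_⟩
  · simpa only [hord] using hint
  · rw [hord, hfl]
    exact hcd.of_le (by norm_num)
  · intro a b
    rw [hord, hfl]
    refine ContDiffOn.absolutelyContinuousOnInterval (ContDiff.contDiffOn ?_)
    rw [iteratedDeriv_one]
    exact hcd2.deriv'
  have hu_inv : u = invF (𝓕 u) := by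
    conv_lhs => rw [← hu_cont.fourierInv_fourier_eq hu hu_hat]
    exact funext fun x => fourierInv_eq_invF _ x
  -- Boundedness of the transform tames the singularity of (2πiω)^(α-2) at 0.
  have hB : ∀ ω, ‖𝓕 u ω‖ ≤ ∫ x, ‖u x‖ := fun ω =>
    VectorFourier.norm_fourierIntegral_le_integral_norm _ _ _ _ ω
  set M := 𝓕 u with hM
  set G : ℝ → ℂ := fun ω => (1 / (2 * Real.pi * Complex.I * ω)) ^ ((2 - α : ℝ) : ℂ) * M ω
    with hGdef
  have hG : Integrable G := integrable_cpow_mul hγ hu_hat hB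
  have hI : rlIntegral (2 - α) u = invF G := by
    ext x
    have hx := hint x
    rw [hu_inv] at hx ⊢
    exact rlIntegral_eq_invF hγ hu_hat hB hx
  rw [hI] at hdiff hac hD hD_hat
  -- The fourth derivative equals the continuous function `invF F` almost everywhere, F being its
  -- transform, and thus becomes classical.
  have h3 := hasDerivAt_of_absolutelyContinuous hac (continuous_invF hD_hat)
    (by rw [← iteratedDeriv_succ]; exact ae_eq_invF_fourier hD hD_hat)
  have h4 := ae_eq_of_hasDerivAt_four hG hD_hat (by simpa using hdiff 0 (by norm_num))
    (hdiff 1 (by norm_num)) (hdiff 2 (by norm_num)) h3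
  have hG4 : Integrable fun ω : ℝ => (2 * Real.pi * Complex.I * ω) ^ 4 * G ω := hD_hat.congr h4
  have hG1 : Integrable fun ω : ℝ => (2 * Real.pi * Complex.I * ω) * G ω := by
    simpa using integrable_pow_mul_of_fourth_moment hG hG4 (j := 1) (by norm_num)
  have hG2 := integrable_pow_mul_of_fourth_moment hG hG4 (j := 2) (by norm_num)
  have e2 : (fun ω : ℝ => (2 * Real.pi * Complex.I * ω) ^ 2 * G ω) =
      fun ω : ℝ => (2 * Real.pi * Complex.I * ω) ^ (α : ℂ) * M ω := by
    ext ω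
    rw [hGdef, ← mul_assoc, sq_mul_one_div_cpow hα0]
  have e2' : (fun ω : ℝ => (2 * Real.pi * Complex.I * ω) *
      ((2 * Real.pi * Complex.I * ω) * G ω)) =
      fun ω : ℝ => (2 * Real.pi * Complex.I * ω) ^ (α : ℂ) * M ω := by
    rw [← e2]; ext ω; ring
  rw [e2] at hG2
  have hderiv : ∀ x, rlDeriv α u x =
      invF (fun ω : ℝ => (2 * Real.pi * Complex.I * ω) ^ (α : ℂ) * M ω) x := by
    intro x
    have d1 : deriv (invF G) = invF fun ω : ℝ => (2 * Real.pi * Complex.I * ω) * G ω :=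
      funext fun y => (hasDerivAt_invF hG hG1 y).deriv
    rw [rlDeriv, hord, hfl, hI, iteratedDeriv_succ, iteratedDeriv_one, d1,
      (hasDerivAt_invF hG1 (by rwa [e2']) x).deriv, e2']
  obtain ⟨C, hC⟩ := exists_norm_invF_sub_wsld2_le hα hpq hu_hat hG2
    (integrable_rpow_mul_of_fourth_moment (γ := 2 - α) (by ring) hu_hat hD_hat h4)
  refine ⟨C, fun h hh x => ⟨?_, ?_, ?_⟩⟩
  · rw [hu_inv]
    exact summable_qCoeff_smul hα _ _
  · rw [hu_inv]
    exact summable_qCoeff_smul hα _ _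
  · have := hC h hh x
    rwa [← hderiv, ← hu_inv] at this
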